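/- Let $\pi:Y\to\mathbb R$ be a smooth fibre bundle over the time axis (coordinate $t$), with finite-dimensional fibres, $Y_t=\pi^{-1}(t)$, and let $\gamma$ be a smooth vector field on $Y$ with $\gamma\rfloor dt=1$, i.e. $\gamma=\partial_t+\gamma^k\partial_k$ in bundle coordinates $(t,y^k)$. A solution of $\gamma$ is a smooth section $s:\mathbb R\to Y$ of $\pi$ with $\dot s(t)=\gamma(s(t))$ for all $t\in\mathbb R$. Assume that $\gamma$ is complete: through each point of $Y$ there passes a (unique) solution. Let $g$ be a Riemannian fibre metric on $Y$, i.e. a smooth positive definite symmetric bilinear form $g=(g_{ij}(t,y))$ on the vertical tangent bundle of $\pi$, and write $g(t)$ for the induced Riemannian metric on $Y_t$. The instantwise distance $\rho_t(s,s')$ of two solutions is the Riemannian distance between $s(t)$ and $s'(t)$ in $(Y_t,g(t))$ (with $\rho_t(s,s')=\infty$ if $s(t)$, $s'(t)$ lie in different components of $Y_t$). The covariant Lyapunov tensor is the Lie derivative $L=\mathbf L_\gamma g$ on vertical vectors, $$L_{ij}=\partial_t g_{ij}+\gamma^k\partial_k g_{ij}+\partial_i\gamma^k g_{kj}+\partial_j\gamma^k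 g_{ik}.$$ An open tubular neighbourhood of a solution $s$ is an open set $U\subset Y$ which contains $s(\mathbb R)$ and is a union of trajectories of $\gamma$ (equivalently, the preimage of an open neighbourhood of $s(t)$ in some fibre $Y_t$ under the projection of $Y$ onto $Y_t$ along the trajectories). Let $s$ be a solution of $\gamma$ and $t_0\in\mathbb R$, and suppose that there is an open tubular neighbourhood $U$ of $s$ such that $L$ is negative definite at every point $y\in U$ with $\pi(y)\ge t_0$. Then $s$ is Lyapunov stable with respect to $g$: for every $t_1\in\mathbb R$ and every $\varepsilon>0$ there is $\delta>0$ such that every solution $s'$ with $\rho_{t_1}(s,s')<\delta$ satisfies $\rho_t(s,s')<\varepsilon$ for all $t>t_1$. -/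

import Mathlib

open Set Topology MeasureTheory
open scoped Manifold ContDiff ENNReal

noncomputable section

namespace DynEq

variable (E : Type*) [NormedAddCommGroup E] [NormedSpace ℝ E]
  {Y : Type*} [TopologicalSpace Y] [ChartedSpace (ℝ × E) Y]

/-- `π : Y → ℝ` is a smooth fibre bundle with typical fibre the manifold `M`: near every instant
there is a local trivialization which is a diffeomorphism onto `baseSet × M` over the time axis. -/
structure IsSmoothFibreBundle (M : Type*) [TopologicalSpace M] [ChartedSpace E M]
    (π : Y → ℝ) : Prop where
  contMDiff : ContMDiff 𝓘(ℝ, ℝ × E) 𝓘(ℝ, ℝ) ∞ π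
  locally_trivial : ∀ t : ℝ, ∃ e : Bundle.Trivialization M π, t ∈ e.baseSet ∧
    ContMDiffOn 𝓘(ℝ, ℝ × E) (𝓘(ℝ, ℝ).prod 𝓘(ℝ, E)) ∞ e e.source ∧
    ContMDiffOn (𝓘(ℝ, ℝ).prod 𝓘(ℝ, E)) 𝓘(ℝ, ℝ × E) ∞ e.toOpenPartialHomeomorph.symm e.target

/-- The fibre at `y` of the vertical tangent bundle `VY` of `π : Y → ℝ`. -/
abbrev Vert (π : Y → ℝ) (y : Y) : Submodule ℝ (TangentSpace 𝓘(ℝ, ℝ × E) y) :=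
  LinearMap.ker (mfderiv 𝓘(ℝ, ℝ × E) 𝓘(ℝ, ℝ) π y).toLinearMap

variable {E}

/-- A bundle chart `(t, y^k)` of `π : Y → ℝ`: a smooth chart of `Y` whose first coordinate is the
time `π`. -/
structure IsBundleChart (π : Y → ℝ) (ψ : OpenPartialHomeomorph Y (ℝ × E)) : Prop where
  mem_maximalAtlas : ψ ∈ IsManifold.maximalAtlas 𝓘(ℝ, ℝ × E) ∞ Y
  fst_eq : ∀ y ∈ ψ.source, (ψ y).1 = π y

/-- The vector at the point with bundle coordinates `z = (t, y^k)` whose coordinates are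
`(0, a^k)`, that is `a^k ∂_k`. -/
def coordVec (ψ : OpenPartialHomeomorph Y (ℝ × E)) (z : ℝ × E) (a : E) :
    TangentSpace 𝓘(ℝ, ℝ × E) (ψ.symm z) :=
  mfderiv 𝓘(ℝ, ℝ × E) 𝓘(ℝ, ℝ × E) ψ.symm z ((0, a) : ℝ × E)

open Classical in
/-- Evaluation of a family of bilinear forms on the vertical tangent spaces at two tangent vectors
`v`, `w` at `y`; it is only ever used for vertical `v`, `w` (the value is set to `0` otherwise). -/
def vertEval {π : Y → ℝ} (B : ∀ y : Y, Vert E π y →ₗ[ℝ] Vert E π y →ₗ[ℝ] ℝ) (y : Y)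
    (v w : TangentSpace 𝓘(ℝ, ℝ × E) y) : ℝ :=
  if h : v ∈ Vert E π y ∧ w ∈ Vert E π y then B y ⟨v, h.1⟩ ⟨w, h.2⟩ else 0

/-- The components `g_{ij}(z) a^i b^j` of a family of bilinear forms on the vertical tangent spaces
in the chart `ψ`. -/
def coordForm {π : Y → ℝ} (B : ∀ y : Y, Vert E π y →ₗ[ℝ] Vert E π y →ₗ[ℝ] ℝ)
    (ψ : OpenPartialHomeomorph Y (ℝ × E)) (z : ℝ × E) (a b : E) : ℝ :=
  vertEval B (ψ.symm z) (coordVec ψ z a) (coordVec ψ z b)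

variable (E) in
/-- A Riemannian fibre metric on `π : Y → ℝ`: a smooth, symmetric, positive definite section of
the second symmetric power of the vertical cotangent bundle. -/
structure RiemannianFibreMetric (π : Y → ℝ) where
  form : ∀ y : Y, Vert E π y →ₗ[ℝ] Vert E π y →ₗ[ℝ] ℝ
  symm : ∀ y v w, form y v w = form y w v
  pos : ∀ y v, v ≠ 0 → 0 < form y v v
  smooth : ∀ ψ : OpenPartialHomeomorph Y (ℝ × E), IsBundleChart π ψ →
    ∀ a b : E, ContDiffOn ℝ ∞ (fun z => coordForm form ψ z a b) ψ.target

/-- A smooth first order dynamic equation on `π : Y → ℝ`: a smooth vector field `γ` on `Y` with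
`γ⌟dt = 1`. -/
structure IsDynamicEquation [IsManifold 𝓘(ℝ, ℝ × E) ∞ Y] (π : Y → ℝ)
    (γ : ∀ y : Y, TangentSpace 𝓘(ℝ, ℝ × E) y) : Prop where
  smooth : ContMDiff 𝓘(ℝ, ℝ × E) 𝓘(ℝ, ℝ × E).tangent ∞
    (fun y => (⟨y, γ y⟩ : TangentBundle 𝓘(ℝ, ℝ × E) Y))
  dt_eq_one : ∀ y, mfderiv 𝓘(ℝ, ℝ × E) 𝓘(ℝ, ℝ) π y (γ y) = (1 : ℝ)

/-- A (global) solution of the dynamic equation `γ`: a trajectory of `γ` parametrized by time. -/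
structure IsSolution (π : Y → ℝ) (γ : ∀ y : Y, TangentSpace 𝓘(ℝ, ℝ × E) y) (s : ℝ → Y) :
    Prop where
  section_eq : ∀ t, π (s t) = t
  integralCurve : IsMIntegralCurve s γ

/-- The field `γ` is complete: there is a global solution through each point of `Y`
(its uniqueness is automatic for a smooth field on a Hausdorff manifold). -/
def IsCompleteEquation (π : Y → ℝ) (γ : ∀ y : Y, TangentSpace 𝓘(ℝ, ℝ × E) y) : Prop :=
  ∀ y : Y, ∃ s : ℝ → Y, IsSolution π γ s ∧ s (π y) = y

/-- The components `γ^k(t, y^j)` of `γ = ∂_t + γ^k ∂_k` in a bundle chart. -/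
def coordField (γ : ∀ y : Y, TangentSpace 𝓘(ℝ, ℝ × E) y)
    (ψ : OpenPartialHomeomorph Y (ℝ × E)) (z : ℝ × E) : E :=
  Prod.snd (α := ℝ) (β := E)
    (mfderiv 𝓘(ℝ, ℝ × E) 𝓘(ℝ, ℝ × E) ψ (ψ.symm z) (γ (ψ.symm z)))

/-- The covariant Lyapunov tensor `L = L_γ g` in the bundle chart `ψ`, at the point with
coordinates `z` and evaluated at vertical vectors with components `a`, `b`:
`L_{ij} = ∂_t g_{ij} + γ^k ∂_k g_{ij} + ∂_i γ^k g_{kj} + ∂_j γ^k g_{ik}`. -/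
def covLyapunov {π : Y → ℝ} (γ : ∀ y : Y, TangentSpace 𝓘(ℝ, ℝ × E) y)
    (g : RiemannianFibreMetric E π) (ψ : OpenPartialHomeomorph Y (ℝ × E)) (z : ℝ × E)
    (a b : E) : ℝ :=
  fderiv ℝ (fun z' => coordForm g.form ψ z' a b) z (1, coordField γ ψ z)
    + coordForm g.form ψ z (fderiv ℝ (coordField γ ψ) z (0, a)) b
    + coordForm g.form ψ z a (fderiv ℝ (coordField γ ψ) z (0, b))

/-- The covariant Lyapunov tensor is negative definite at `y`. Being a tensor, it is negative
definite in one bundle chart around `y` if and only if it is so in all of them. -/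
def LyapunovNegDefAt {π : Y → ℝ} (γ : ∀ y : Y, TangentSpace 𝓘(ℝ, ℝ × E) y)
    (g : RiemannianFibreMetric E π) (y : Y) : Prop :=
  ∃ ψ : OpenPartialHomeomorph Y (ℝ × E), IsBundleChart π ψ ∧ y ∈ ψ.source ∧
    ∀ a : E, a ≠ 0 → covLyapunov γ g ψ (ψ y) a a < 0

/-- `U` is an open tubular neighbourhood of the trajectory `s`: an open set which contains `s` and
is a union of trajectories, i.e. the preimage of an open set of a fibre under the fibration of `Y`
along the trajectories of the complete field `γ`. -/
structure IsTubularNhd (π : Y → ℝ) (γ : ∀ y : Y, TangentSpace 𝓘(ℝ, ℝ × E) y) (s : ℝ → Y)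
    (U : Set Y) : Prop where
  isOpen : IsOpen U
  mem : ∀ t, s t ∈ U
  saturated : ∀ s' : ℝ → Y, IsSolution π γ s' → (∃ t, s' t ∈ U) → ∀ t, s' t ∈ U

/-- The length, with respect to the fibre metric `g`, of a curve `c : [0, 1] → Y` which lies in one
fibre of `π`. -/
def fibreLength {π : Y → ℝ} (g : RiemannianFibreMetric E π) (c : ℝ → Y) : ℝ≥0∞ :=
  ∫⁻ τ in Icc (0 : ℝ) 1, ENNReal.ofReal (Real.sqrt (vertEval g.form (c τ)
    (mfderivWithin 𝓘(ℝ, ℝ) 𝓘(ℝ, ℝ × E) c (Icc 0 1) τ (1 : ℝ))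
    (mfderivWithin 𝓘(ℝ, ℝ) 𝓘(ℝ, ℝ × E) c (Icc 0 1) τ (1 : ℝ))))

/-- The Riemannian distance between `x` and `y` in the fibre `Y_t`, `t = π x`, with the metric
`g(t)`: the infimum of the lengths of the `C^1` curves from `x` to `y` in that fibre (`∞` if there
are none). -/
def fibreEDist {π : Y → ℝ} (g : RiemannianFibreMetric E π) (x y : Y) : ℝ≥0∞ :=
  ⨅ (c : ℝ → Y) (_ : ContMDiffOn 𝓘(ℝ, ℝ) 𝓘(ℝ, ℝ × E) 1 c (Icc 0 1) ∧ c 0 = x ∧ c 1 = y ∧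
    ∀ τ ∈ Icc (0 : ℝ) 1, π (c τ) = π x), fibreLength g c

/-- The instantwise distance `ρ_t(s, s')` between two solutions. -/
def instDist {π : Y → ℝ} (g : RiemannianFibreMetric E π) (t : ℝ) (s s' : ℝ → Y) : ℝ≥0∞ :=
  fibreEDist g (s t) (s' t)

/-- The solution `s` of `γ` is Lyapunov stable (in the positive direction) with respect to the
Riemannian fibre metric `g`. -/
def IsLyapunovStable {π : Y → ℝ} (γ : ∀ y : Y, TangentSpace 𝓘(ℝ, ℝ × E) y)
    (g : RiemannianFibreMetric E π) (s : ℝ → Y) : Prop :=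
  ∀ t₁ : ℝ, ∀ ε : ℝ, 0 < ε → ∃ δ : ℝ, 0 < δ ∧ ∀ s' : ℝ → Y, IsSolution π γ s' →
    instDist g t₁ s s' < ENNReal.ofReal δ → ∀ t : ℝ, t₁ < t → instDist g t s s' < ENNReal.ofReal ε

end DynEq

end

/-!
# Lyapunov stability from a negative definite Lyapunov tensor

Completeness of `γ` gives a flow `flow h : Y → Y` which carries the fibre over `t` to the fibre
over `t + h`. For a vertical vector `v` the derivative of `g (D(flow h) v, D(flow h) v)` in `h` is
the Lyapunov tensor evaluated at `D(flow h) v` (`hasDerivAt_flowSqNorm_zero`). Hence a bound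
`L ≤ K g` along a trajectory makes the squared lengths of vertical vectors grow at most like
`exp (K h)` (`flowSqNorm_le_exp_mul`), and lengths of curves in the fibres grow accordingly
(`fibreLength_flow_comp_le`). Where `L` is negative definite one may take `K = 0`. Before the time
`T = max t₀ t₁` nothing is assumed on `L`, but by compactness `L ≤ K g` holds for some `K` on a
neighbourhood of the compact piece of `s` between `t₁` and `T`
(`exists_isOpen_lyapunovLeAt_of_isCompact`).

Given a solution `s'` with `s' t₁` close to `s t₁`, choose a short curve between these two points
in the fibre over `t₁`. The curve need not be minimal, but since it is short it stays in a
prescribed neighbourhood of `s t₁` (`exists_forall_mem_of_fibreLength_lt`); so its points have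
trajectories which satisfy both bounds. The image of the curve under the flow joins `s t` to `s' t`
and its length is at most a fixed multiple of the length of the curve.

For the image to be a `C^1` curve, and for the formula for the derivative, the flow has to be
differentiable in the initial point. In a chart this is obtained from the Picard-Lindelöf theorem,
applied to the field together with its variational equation, and Grönwall's inequality
(`exists_local_flow`); the group law extends it to all times (`contMDiffAt_flow`).
-/

open Set Topology MeasureTheory
open scoped Manifold ContDiff ENNReal

/-! ### Differentiable dependence of local flows on the initial condition -/

section LocalFlow

variable {F : Type*} [NormedAddCommGroup F] [NormedSpace ℝ F]

/-- Grönwall's inequality for a curve vanishing at `0`, on both sides of `0`. -/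
lemma norm_le_gronwallBound_of_abs_lt {e e' : ℝ → F} {K ε η : ℝ} (h0 : e 0 = 0)
    (hd : ∀ h, |h| < η → HasDerivAt e (e' h) h)
    (hb : ∀ h, |h| < η → ‖e' h‖ ≤ K * ‖e h‖ + ε) (h : ℝ) (hh : |h| < η) :
    ‖e h‖ ≤ gronwallBound 0 K ε |h| := by
  have forward : ∀ (u u' : ℝ → F), u 0 = 0 → (∀ h, |h| < η → HasDerivAt u (u' h) h) →
      (∀ h, |h| < η → ‖u' h‖ ≤ K * ‖u h‖ + ε) →
      ∀ h, 0 ≤ h → h < η → ‖u h‖ ≤ gronwallBound 0 K ε h := by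
    intro u u' h0 hd hb h hh0 hh
    have hlt : ∀ x ∈ Icc 0 h, |x| < η := fun x hx => by
      rw [abs_of_nonneg hx.1]; exact hx.2.trans_lt hh
    have := norm_le_gronwallBound_of_norm_deriv_right_le (f := u) (f' := u') (δ := 0) (K := K)
      (ε := ε) (a := 0) (b := h)
      (fun x hx => (hd x (hlt x hx)).continuousAt.continuousWithinAt)
      (fun x hx => (hd x (hlt x (Ico_subset_Icc_self hx))).hasDerivWithinAt)
      (by simp [h0]) (fun x hx => hb x (hlt x (Ico_subset_Icc_self hx))) h ⟨hh0, le_rfl⟩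
    simpa using this
  rcases le_total 0 h with hs | hs
  · rw [abs_of_nonneg hs] at hh ⊢
    exact forward e e' h0 hd hb h hs hh
  · rw [abs_of_nonpos hs] at hh ⊢
    have := forward (fun x => e (-x)) (fun x => -e' (-x)) (by simpa using h0)
      (fun x hx => by
        have := (hd (-x) (by simpa using hx)).scomp x (hasDerivAt_neg x)
        simpa [Function.comp_def] using this)
      (fun x hx => by simpa using hb (-x) (by simpa using hx)) (-h) (by linarith) hh
    simpa using this

/-- First order Taylor estimate for a map with Lipschitz derivative. -/
lemma norm_sub_sub_le_sq_of_lipschitz_fderiv {f : F → F} {f' : F → F →L[ℝ] F} {B : Set F}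
    (hB : Convex ℝ B) {C : ℝ} (hC : 0 ≤ C) (hf : ∀ z ∈ B, HasFDerivAt f (f' z) z)
    (hl : ∀ z ∈ B, ∀ z' ∈ B, ‖f' z - f' z'‖ ≤ C * ‖z - z'‖) {z z' : F} (hz : z ∈ B)
    (hz' : z' ∈ B) : ‖f z' - f z - f' z (z' - z)‖ ≤ C * ‖z' - z‖ ^ 2 := by
  have hsub := hB.segment_subset hz hz'
  have := (convex_segment z z').norm_image_sub_le_of_norm_hasFDerivWithin_le'
    (f := f) (f' := f') (φ := f' z) (C := C * ‖z' - z‖)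
    (fun x hx => (hf x (hsub hx)).hasFDerivWithinAt)
    (fun x hx => (hl x (hsub hx) z hz).trans (by
      gcongr
      obtain ⟨θ, hθ, rfl⟩ := (segment_eq_image' ℝ z z' ▸ hx :)
      simp only [add_sub_cancel_left, norm_smul, Real.norm_eq_abs, abs_of_nonneg hθ.1]
      exact mul_le_of_le_one_left (norm_nonneg _) hθ.2))
    (left_mem_segment ℝ z z') (right_mem_segment ℝ z z')
  rw [sq, ← mul_assoc]; exact this

/-- A family of trajectories which depends Lipschitz continuously on its initial points is
differentiable in them, the derivative being the solution of the variational equation. -/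
lemma hasFDerivAt_of_variational_equation {f : F → F} {f' : F → F →L[ℝ] F} {B : Set F}
    (hB : Convex ℝ B) {C K : ℝ} (hC : 0 ≤ C) (hK : 0 < K)
    (hf : ∀ z ∈ B, HasFDerivAt f (f' z) z)
    (hl : ∀ z ∈ B, ∀ z' ∈ B, ‖f' z - f' z'‖ ≤ C * ‖z - z'‖) (hfK : ∀ z ∈ B, ‖f' z‖ ≤ K)
    {α : F → ℝ → F} {A : ℝ → F →L[ℝ] F} {V : Set F} {z : F} (hV : V ∈ 𝓝 z) {η Λ : ℝ}
    (hα0 : ∀ z ∈ V, α z 0 = z) (hαB : ∀ z ∈ V, ∀ h, |h| < η → α z h ∈ B)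
    (hα : ∀ z ∈ V, ∀ h, |h| < η → HasDerivAt (α z) (f (α z h)) h)
    (hαl : ∀ z' ∈ V, ∀ h, |h| < η → ‖α z' h - α z h‖ ≤ Λ * ‖z' - z‖)
    (hA0 : A 0 = ContinuousLinearMap.id ℝ F)
    (hA : ∀ h, |h| < η → HasDerivAt A (f' (α z h) ∘L A h) h) {h : ℝ} (hh : |h| < η) :
    HasFDerivAt (fun z' => α z' h) (A h) z := by
  have hzV : z ∈ V := mem_of_mem_nhds hV
  -- the remainder solves the linearized equation up to an error quadratic in `z' - z`
  have key : ∀ z' ∈ V, ‖α z' h - α z h - A h (z' - z)‖ ≤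
      (C * Λ ^ 2 / K * (Real.exp (K * |h|) - 1)) * ‖z' - z‖ ^ 2 := by
    intro z' hz'
    have := norm_le_gronwallBound_of_abs_lt (η := η) (K := K) (ε := C * Λ ^ 2 * ‖z' - z‖ ^ 2)
      (e := fun h => α z' h - α z h - A h (z' - z))
      (e' := fun h => f (α z' h) - f (α z h) - (f' (α z h) ∘L A h) (z' - z))
      (by simp [hα0 z' hz', hα0 z hzV, hA0])
      (fun h hh => ((hα z' hz' h hh).sub (hα z hzV h hh)).sub
        ((hA h hh).clm_apply (hasDerivAt_const h (z' - z)) |>.congr_deriv (by simp)))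
      (fun h hh => by
        have h1 := norm_sub_sub_le_sq_of_lipschitz_fderiv hB hC hf hl (hαB z hzV h hh)
          (hαB z' hz' h hh)
        have h2 : ‖f' (α z h) (α z' h - α z h - A h (z' - z))‖ ≤
            K * ‖α z' h - α z h - A h (z' - z)‖ :=
          ((f' (α z h)).le_opNorm _).trans (by gcongr; exact hfK _ (hαB z hzV h hh))
        have h3 : ‖α z' h - α z h‖ ^ 2 ≤ (Λ * ‖z' - z‖) ^ 2 := by
          gcongr; exact hαl z' hz' h hh
        have h4 : f (α z' h) - f (α z h) - (f' (α z h) ∘L A h) (z' - z) =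
            (f (α z' h) - f (α z h) - f' (α z h) (α z' h - α z h)) +
              f' (α z h) (α z' h - α z h - A h (z' - z)) := by
          simp only [map_sub, ContinuousLinearMap.comp_apply]; abel
        rw [h4]
        refine (norm_add_le _ _).trans ?_
        have h5 := mul_le_mul_of_nonneg_left h3 hC
        rw [mul_pow, ← mul_assoc] at h5
        linarith) h hh
    rw [gronwallBound_of_K_ne_0 hK.ne'] at this
    refine this.trans (le_of_eq ?_)
    ring
  rw [hasFDerivAt_iff_isLittleO]
  have hO : (fun z' => α z' h - α z h - A h (z' - z)) =O[𝓝 z] fun z' => ‖z' - z‖ ^ 2 :=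
    Asymptotics.IsBigO.of_bound _ (by
      filter_upwards [hV] with z' hz'
      simpa using key z' hz')
  refine hO.trans_isLittleO ?_
  have := (Asymptotics.isLittleO_norm_pow_id (E' := F) one_lt_two)
  exact (this.comp_tendsto (k := fun z' => z' - z)
    (tendsto_sub_nhds_zero_iff.2 Filter.tendsto_id))

/-- The local flow of a `C^2` vector field `f` near `z₀`, together with its derivative `A` in the
initial point: both are obtained from the flow of the field `(z, A) ↦ (f z, f' z ∘ A)`. -/
theorem exists_local_flow [CompleteSpace F] {f : F → F} {z₀ : F} (hf : ContDiffAt ℝ 2 f z₀)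
    {N : Set F} (hN : N ∈ 𝓝 z₀) :
    ∃ η > 0, ∃ V ∈ 𝓝 z₀, ∃ (α : F → ℝ → F) (A : F → ℝ → F →L[ℝ] F), IsOpen V ∧
      (∀ z ∈ V, α z 0 = z ∧ A z 0 = ContinuousLinearMap.id ℝ F) ∧
      (∀ z ∈ V, ∀ h, |h| < η → α z h ∈ N ∧ HasDerivAt (α z) (f (α z h)) h ∧
        HasDerivAt (A z) (fderiv ℝ f (α z h) ∘L A z h) h ∧
        HasFDerivAt (fun z' => α z' h) (A z h) z) ∧
      (∀ h, |h| < η → ContinuousOn (fun z => A z h) V) ∧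
      ContinuousOn (fun p : F × ℝ => α p.1 p.2) (V ×ˢ Ioo (-η) η) := by
  have hf' : ContDiffAt ℝ 1 (fderiv ℝ f) z₀ := hf.fderiv_right (by norm_num)
  obtain ⟨C, S, hS, hlip⟩ := hf'.exists_lipschitzOnWith
  have hdiff : ∀ᶠ z in 𝓝 z₀, DifferentiableAt ℝ f z :=
    (hf.eventually (by simp)).mono fun z hz => hz.differentiableAt (by norm_num)
  have hbd : ∀ᶠ z in 𝓝 z₀, ‖fderiv ℝ f z‖ < ‖fderiv ℝ f z₀‖ + 1 :=
    hf'.continuousAt.norm.eventually_lt continuousAt_const (by simp)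
  obtain ⟨R, hR, hRsub⟩ := Metric.eventually_nhds_iff_ball.1
    ((hdiff.and hbd).and (Filter.eventually_of_mem (Filter.inter_mem hN hS) fun z hz => hz))
  set X₀ : F × (F →L[ℝ] F) := (z₀, ContinuousLinearMap.id ℝ F)
  have hΦ : ContDiffAt ℝ 1 (fun X : F × (F →L[ℝ] F) => (f X.1, fderiv ℝ f X.1 ∘L X.2)) X₀ := by
    refine ContDiffAt.prodMk ?_ ?_
    · exact (hf.of_le (by norm_num)).comp X₀ contDiffAt_fst
    · exact (ContDiffAt.comp (f := Prod.fst) X₀ hf' contDiffAt_fst).clm_comp contDiffAt_snd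
  obtain ⟨ε, hε, a, r, L, K, hr, hPL⟩ := IsPicardLindelof.of_contDiffAt_one hΦ
  obtain ⟨β, hβ, Λ, hβl⟩ :=
    (hPL 0).exists_forall_mem_closedBall_eq_hasDerivWithinAt_lipschitzOnWith
  simp only [zero_sub, zero_add] at hβ hβl
  have hβc : ContinuousOn (fun p : (F × (F →L[ℝ] F)) × ℝ => β p.1 p.2)
      (Metric.closedBall X₀ r ×ˢ Icc (-ε) ε) :=
    continuousOn_prod_of_continuousOn_lipschitzOnWith _ Λ
      (fun x hx => HasDerivWithinAt.continuousOn (hβ x hx).2) hβl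
  have hr' : (0 : ℝ) < r := by exact_mod_cast hr
  have hβc0 : ContinuousAt (fun p : (F × (F →L[ℝ] F)) × ℝ => β p.1 p.2) (X₀, 0) :=
    hβc.continuousAt (prod_mem_nhds (Metric.closedBall_mem_nhds _ hr')
      (Icc_mem_nhds (by linarith) hε))
  have hβ0 : β X₀ 0 = X₀ := (hβ X₀ (Metric.mem_closedBall_self hr'.le)).1
  have hev : ∀ᶠ p : (F × (F →L[ℝ] F)) × ℝ in 𝓝 (X₀, 0), (β p.1 p.2).1 ∈ Metric.ball z₀ R := by
    refine (continuous_fst.continuousAt.comp hβc0) ?_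
    simp only [Function.comp_apply, hβ0]
    exact Metric.ball_mem_nhds _ hR
  obtain ⟨ρ, hρ, hball⟩ := Metric.eventually_nhds_iff_ball.1 hev
  have hr₁ : 0 < min (r : ℝ) ρ := lt_min hr' hρ
  have hη : 0 < min ε ρ := lt_min hε hρ
  have hmem : ∀ z ∈ Metric.ball z₀ (min (r : ℝ) ρ),
      (z, ContinuousLinearMap.id ℝ F) ∈ Metric.closedBall X₀ r := fun z hz => by
    have : dist z z₀ ≤ r := (Metric.mem_ball.1 hz).le.trans (min_le_left _ _)
    simpa [X₀, Prod.dist_eq] using this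
  have hIcc : ∀ h : ℝ, |h| < min ε ρ → h ∈ Ioo (-ε) ε := fun h hh =>
    abs_lt.1 (hh.trans_le (min_le_left _ _))
  have hder : ∀ z ∈ Metric.ball z₀ (min (r : ℝ) ρ), ∀ h, |h| < min ε ρ →
      HasDerivAt (β (z, ContinuousLinearMap.id ℝ F))
        (f (β (z, ContinuousLinearMap.id ℝ F) h).1,
          fderiv ℝ f (β (z, ContinuousLinearMap.id ℝ F) h).1 ∘L
            (β (z, ContinuousLinearMap.id ℝ F) h).2) h := fun z hz h hh =>
    ((hβ _ (hmem z hz)).2 h (Ioo_subset_Icc_self (hIcc h hh))).hasDerivAt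
      (Icc_mem_nhds (hIcc h hh).1 (hIcc h hh).2)
  have hin : ∀ z ∈ Metric.ball z₀ (min (r : ℝ) ρ), ∀ h, |h| < min ε ρ →
      (β (z, ContinuousLinearMap.id ℝ F) h).1 ∈ Metric.ball z₀ R := fun z hz h hh => by
    refine hball ((z, ContinuousLinearMap.id ℝ F), h) ?_
    have h1 : dist z z₀ < ρ := (Metric.mem_ball.1 hz).trans_le (min_le_right _ _)
    have h2 : |h| < ρ := hh.trans_le (min_le_right _ _)
    simp [X₀, Prod.dist_eq, h1, h2]
  have hLip : ∀ z ∈ Metric.ball z₀ (min (r : ℝ) ρ), ∀ z' ∈ Metric.ball z₀ (min (r : ℝ) ρ),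
      ∀ h, |h| < min ε ρ → dist (β (z, ContinuousLinearMap.id ℝ F) h)
        (β (z', ContinuousLinearMap.id ℝ F) h) ≤ Λ * dist z z' := fun z hz z' hz' h hh => by
    have := (hβl h (Ioo_subset_Icc_self (hIcc h hh))).dist_le_mul _ (hmem z hz) _ (hmem z' hz')
    simpa [Prod.dist_eq] using this
  refine ⟨min ε ρ, hη, Metric.ball z₀ (min (r : ℝ) ρ), Metric.ball_mem_nhds _ hr₁,
    fun z h => (β (z, ContinuousLinearMap.id ℝ F) h).1,
    fun z h => (β (z, ContinuousLinearMap.id ℝ F) h).2, Metric.isOpen_ball, fun z hz => ?_,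
    fun z hz h hh => ⟨?_, ?_, ?_, ?_⟩, fun h hh => ?_, ?_⟩
  · simp [(hβ _ (hmem z hz)).1]
  · exact (hRsub _ (hin z hz h hh)).2.1
  · exact (hder z hz h hh).fst
  · exact (hder z hz h hh).snd
  · refine hasFDerivAt_of_variational_equation (f := f) (f' := fderiv ℝ f)
      (convex_ball z₀ R) (C := C) (K := ‖fderiv ℝ f z₀‖ + 1) C.2 (by positivity)
      (fun z hz => (hRsub z hz).1.1.hasFDerivAt) (fun z hz z' hz' => ?_)
      (fun z hz => (hRsub z hz).1.2.le) (V := Metric.ball z₀ (min (r : ℝ) ρ))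
      (α := fun z h => (β (z, ContinuousLinearMap.id ℝ F) h).1)
      (Metric.isOpen_ball.mem_nhds hz) (η := min ε ρ) (Λ := Λ)
      (fun z hz => by simp [(hβ _ (hmem z hz)).1]) hin
      (fun z hz h hh => (hder z hz h hh).fst) (fun z' hz' h hh => ?_)
      (by simp [(hβ _ (hmem z hz)).1]) (fun h hh => (hder z hz h hh).snd) hh
    · simpa [dist_eq_norm] using hlip.dist_le_mul z (hRsub z hz).2.2 z' (hRsub z' hz').2.2
    · have := hLip z' hz' z hz h hh
      rw [Prod.dist_eq] at this
      simpa [dist_eq_norm] using (le_max_left _ _).trans this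
  · refine LipschitzOnWith.continuousOn (K := Λ) (LipschitzOnWith.of_dist_le_mul ?_)
    intro z hz z' hz'
    have := hLip z hz z' hz' h hh
    rw [Prod.dist_eq] at this
    exact (le_max_right _ _).trans this
  · refine continuous_fst.comp_continuousOn (hβc.comp (f := fun p : F × ℝ =>
      ((p.1, ContinuousLinearMap.id ℝ F), p.2)) (by fun_prop) fun p hp => ⟨hmem _ hp.1, ?_⟩)
    exact Ioo_subset_Icc_self (hIcc _ (abs_lt.2 hp.2))

end LocalFlow

namespace DynEq

variable {E : Type*} [NormedAddCommGroup E] [NormedSpace ℝ E]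
  {Y : Type*} [TopologicalSpace Y] [ChartedSpace (ℝ × E) Y]
  {π : Y → ℝ} {ψ : OpenPartialHomeomorph Y (ℝ × E)}

/-! ### Bundle charts -/

lemma preimage_chart_mem_nhds {X H : Type*} [TopologicalSpace X] [TopologicalSpace H]
    {ψ : OpenPartialHomeomorph X H} {y : X} (hy : y ∈ ψ.source) {V : Set H} (hV : V ∈ 𝓝 (ψ y)) :
    ψ.source ∩ ψ ⁻¹' V ∈ 𝓝 y :=
  Filter.inter_mem (ψ.open_source.mem_nhds hy) (ψ.continuousAt hy hV)

/-- Bundle charts exist around every point: compose a local trivialization with a chart of the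
typical fibre. -/
lemma IsSmoothFibreBundle.exists_isBundleChart {M : Type*} [TopologicalSpace M]
    [ChartedSpace E M] [IsManifold 𝓘(ℝ, E) ∞ M] [IsManifold 𝓘(ℝ, ℝ × E) ∞ Y]
    (hπ : IsSmoothFibreBundle E M π) (y : Y) :
    ∃ ψ : OpenPartialHomeomorph Y (ℝ × E), IsBundleChart π ψ ∧ y ∈ ψ.source := by
  obtain ⟨e, he, hs, hs'⟩ := hπ.locally_trivial (π y)
  have hy : y ∈ e.source := e.mem_source.2 he
  set φ := chartAt E (e y).2
  set χ : OpenPartialHomeomorph (ℝ × M) (ℝ × E) := (OpenPartialHomeomorph.refl ℝ).prod φ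
  have hχ : ContMDiffOn (𝓘(ℝ, ℝ).prod 𝓘(ℝ, E)) 𝓘(ℝ, ℝ × E) ∞ χ χ.source := by
    refine ContMDiffOn.prodMk_space contMDiffOn_fst ?_
    exact (contMDiffOn_chart (I := 𝓘(ℝ, E)) (x := (e y).2)).comp contMDiffOn_snd
      fun p hp => hp.2
  have hχ' : ContMDiffOn 𝓘(ℝ, ℝ × E) (𝓘(ℝ, ℝ).prod 𝓘(ℝ, E)) ∞ χ.symm χ.target := by
    refine ContMDiffOn.prodMk contDiff_fst.contMDiff.contMDiffOn ?_
    exact (contMDiffOn_chart_symm (I := 𝓘(ℝ, E)) (x := (e y).2)).comp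
      contDiff_snd.contMDiff.contMDiffOn fun p hp => hp.2
  refine ⟨e.toOpenPartialHomeomorph ≫ₕ χ, ⟨?_, fun x hx => ?_⟩, ?_⟩
  · refine OpenPartialHomeomorph.mem_maximalAtlas_of_contMDiffOn _ ?_ ?_
    · exact hχ.comp (hs.mono fun x hx => hx.1) fun x hx => hx.2
    · exact hs'.comp (hχ'.mono fun x hx => hx.1) fun x hx => hx.2
  · exact e.coe_fst hx.1
  · exact ⟨hy, mem_univ _, mem_chart_source E _⟩

namespace IsBundleChart

lemma mdifferentiable [IsManifold 𝓘(ℝ, ℝ × E) ∞ Y] (hψ : IsBundleChart π ψ) :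
    ψ.MDifferentiable 𝓘(ℝ, ℝ × E) 𝓘(ℝ, ℝ × E) :=
  ⟨(contMDiffOn_of_mem_maximalAtlas hψ.mem_maximalAtlas).mdifferentiableOn (by simp),
    (contMDiffOn_symm_of_mem_maximalAtlas hψ.mem_maximalAtlas).mdifferentiableOn (by simp)⟩

variable [IsManifold 𝓘(ℝ, ℝ × E) ∞ Y]

lemma mfderiv_proj (hψ : IsBundleChart π ψ) {y : Y} (hy : y ∈ ψ.source)
    (v : TangentSpace 𝓘(ℝ, ℝ × E) y) :
    mfderiv 𝓘(ℝ, ℝ × E) 𝓘(ℝ, ℝ) π y v =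
      Prod.fst (α := ℝ) (β := E) (mfderiv 𝓘(ℝ, ℝ × E) 𝓘(ℝ, ℝ × E) ψ y v) := by
  have h1 := ((ContinuousLinearMap.fst ℝ ℝ E).hasMFDerivAt (x := ψ y)).comp y
    (hψ.mdifferentiable.mdifferentiableAt hy).hasMFDerivAt
  have h2 : HasMFDerivAt 𝓘(ℝ, ℝ × E) 𝓘(ℝ, ℝ) π y _ := h1.congr_of_eventuallyEq
    (by filter_upwards [ψ.open_source.mem_nhds hy] with x hx using (hψ.fst_eq x hx).symm)
  rw [h2.mfderiv]
  rfl

lemma mem_vert_iff (hψ : IsBundleChart π ψ) {y : Y} (hy : y ∈ ψ.source)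
    (v : TangentSpace 𝓘(ℝ, ℝ × E) y) :
    v ∈ Vert E π y ↔
      Prod.fst (α := ℝ) (β := E) (mfderiv 𝓘(ℝ, ℝ × E) 𝓘(ℝ, ℝ × E) ψ y v) = 0 := by
  rw [← hψ.mfderiv_proj hy]
  exact LinearMap.mem_ker

lemma mfderiv_symm_apply (hψ : IsBundleChart π ψ) {z : ℝ × E} (hz : z ∈ ψ.target) (w : ℝ × E) :
    mfderiv 𝓘(ℝ, ℝ × E) 𝓘(ℝ, ℝ × E) ψ (ψ.symm z)
      (mfderiv 𝓘(ℝ, ℝ × E) 𝓘(ℝ, ℝ × E) ψ.symm z w) = w :=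
  DFunLike.congr_fun (hψ.mdifferentiable.comp_symm_deriv hz) w

lemma symm_mfderiv_apply (hψ : IsBundleChart π ψ) {y : Y} (hy : y ∈ ψ.source)
    (v : TangentSpace 𝓘(ℝ, ℝ × E) y) :
    mfderiv 𝓘(ℝ, ℝ × E) 𝓘(ℝ, ℝ × E) ψ.symm (ψ y)
      (mfderiv 𝓘(ℝ, ℝ × E) 𝓘(ℝ, ℝ × E) ψ y v) = v :=
  DFunLike.congr_fun (hψ.mdifferentiable.symm_comp_deriv hy) v

lemma coordVec_mem_vert (hψ : IsBundleChart π ψ) {z : ℝ × E} (hz : z ∈ ψ.target) (a : E) :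
    coordVec ψ z a ∈ Vert E π (ψ.symm z) := by
  rw [hψ.mem_vert_iff (ψ.map_target hz), coordVec, hψ.mfderiv_symm_apply hz]

lemma coordVec_mfderiv (hψ : IsBundleChart π ψ) {y : Y} (hy : y ∈ ψ.source)
    {v : TangentSpace 𝓘(ℝ, ℝ × E) y} (hv : v ∈ Vert E π y) :
    coordVec ψ (ψ y) (Prod.snd (α := ℝ) (β := E) (mfderiv 𝓘(ℝ, ℝ × E) 𝓘(ℝ, ℝ × E) ψ y v)) = v := by
  rw [hψ.mem_vert_iff hy] at hv
  conv_rhs => rw [← hψ.symm_mfderiv_apply hy v]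
  rw [coordVec]
  congr 1
  exact Prod.ext hv.symm rfl

end IsBundleChart

lemma vertEval_of_mem (B : ∀ y : Y, Vert E π y →ₗ[ℝ] Vert E π y →ₗ[ℝ] ℝ) {y : Y}
    {v w : TangentSpace 𝓘(ℝ, ℝ × E) y} (hv : v ∈ Vert E π y) (hw : w ∈ Vert E π y) :
    vertEval B y v w = B y ⟨v, hv⟩ ⟨w, hw⟩ :=
  dif_pos ⟨hv, hw⟩

lemma vertEval_congr (B : ∀ y : Y, Vert E π y →ₗ[ℝ] Vert E π y →ₗ[ℝ] ℝ) {y y' : Y} (h : y = y')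
    {v w v' w' : ℝ × E} (hv : v = v') (hw : w = w') :
    vertEval B y (v : TangentSpace 𝓘(ℝ, ℝ × E) y) (w : TangentSpace 𝓘(ℝ, ℝ × E) y) =
      vertEval B y' (v' : TangentSpace 𝓘(ℝ, ℝ × E) y') (w' : TangentSpace 𝓘(ℝ, ℝ × E) y') := by
  subst h hv hw; rfl

lemma vertEval_self_nonneg (g : RiemannianFibreMetric E π) (y : Y)
    (v : TangentSpace 𝓘(ℝ, ℝ × E) y) : 0 ≤ vertEval g.form y v v := by
  rw [vertEval]
  split_ifs with h
  · rcases eq_or_ne (⟨v, h.1⟩ : Vert E π y) 0 with h0 | h0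
    · rw [h0]; simp
    · exact (g.pos y _ h0).le
  · exact le_rfl

namespace IsBundleChart

variable [IsManifold 𝓘(ℝ, ℝ × E) ∞ Y]

lemma vertEval_eq_coordForm (hψ : IsBundleChart π ψ)
    (B : ∀ y : Y, Vert E π y →ₗ[ℝ] Vert E π y →ₗ[ℝ] ℝ) {y : Y} (hy : y ∈ ψ.source)
    {v w : TangentSpace 𝓘(ℝ, ℝ × E) y} (hv : v ∈ Vert E π y) (hw : w ∈ Vert E π y) :
    vertEval B y v w = coordForm B ψ (ψ y)
      (Prod.snd (α := ℝ) (β := E) (mfderiv 𝓘(ℝ, ℝ × E) 𝓘(ℝ, ℝ × E) ψ y v))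
      (Prod.snd (α := ℝ) (β := E) (mfderiv 𝓘(ℝ, ℝ × E) 𝓘(ℝ, ℝ × E) ψ y w)) :=
  vertEval_congr B (ψ.left_inv hy).symm (hψ.coordVec_mfderiv hy hv).symm
    (hψ.coordVec_mfderiv hy hw).symm

lemma coordForm_pos (hψ : IsBundleChart π ψ) (g : RiemannianFibreMetric E π) {z : ℝ × E}
    (hz : z ∈ ψ.target) {a : E} (ha : a ≠ 0) : 0 < coordForm g.form ψ z a a := by
  rw [coordForm, vertEval_of_mem _ (hψ.coordVec_mem_vert hz a) (hψ.coordVec_mem_vert hz a)]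
  refine g.pos _ _ fun h => ha ?_
  have h1 : coordVec ψ z a = 0 := congrArg Subtype.val h
  have h2 := hψ.mfderiv_symm_apply hz (0, a)
  rw [coordVec] at h1
  rw [h1, map_zero] at h2
  exact (congrArg Prod.snd h2).symm

/-- The components of a fibre metric in a bundle chart form a smooth family of continuous bilinear
forms. -/
lemma exists_coordForm_eq [FiniteDimensional ℝ E] (hψ : IsBundleChart π ψ)
    (g : RiemannianFibreMetric E π) :
    ∃ G : ℝ × E → E →L[ℝ] E →L[ℝ] ℝ, ContDiffOn ℝ ∞ G ψ.target ∧
      ∀ z ∈ ψ.target, ∀ a b, coordForm g.form ψ z a b = G z a b := by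
  classical
  let c : ∀ z ∈ ψ.target, E →ₗ[ℝ] Vert E π (ψ.symm z) := fun z hz =>
    LinearMap.codRestrict _ ((mfderiv 𝓘(ℝ, ℝ × E) 𝓘(ℝ, ℝ × E) ψ.symm z).toLinearMap ∘ₗ
      LinearMap.inr ℝ ℝ E) (hψ.coordVec_mem_vert hz)
  let G : ℝ × E → E →L[ℝ] E →L[ℝ] ℝ := fun z =>
    if hz : z ∈ ψ.target then
      LinearMap.toContinuousLinearMap (LinearMap.toContinuousLinearMap.toLinearMap ∘ₗ
        ((g.form (ψ.symm z)).compl₁₂ (c z hz) (c z hz)))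
    else 0
  have hG : ∀ z ∈ ψ.target, ∀ a b, coordForm g.form ψ z a b = G z a b := fun z hz a b => by
    rw [coordForm, vertEval_of_mem _ (hψ.coordVec_mem_vert hz a) (hψ.coordVec_mem_vert hz b)]
    simp only [G, dif_pos hz]
    rfl
  refine ⟨G, ?_, hG⟩
  rw [contDiffOn_clm_apply]
  intro a
  rw [contDiffOn_clm_apply]
  intro b
  exact (g.smooth ψ hψ a b).congr fun z hz => (hG z hz a b).symm

end IsBundleChart

/-- The representative of the vector field `γ` in the chart `ψ`. -/
noncomputable def chartField (γ : ∀ y : Y, TangentSpace 𝓘(ℝ, ℝ × E) y)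
    (ψ : OpenPartialHomeomorph Y (ℝ × E)) (z : ℝ × E) : ℝ × E :=
  mfderiv 𝓘(ℝ, ℝ × E) 𝓘(ℝ, ℝ × E) ψ (ψ.symm z) (γ (ψ.symm z))

variable [IsManifold 𝓘(ℝ, ℝ × E) ∞ Y] {γ : ∀ y : Y, TangentSpace 𝓘(ℝ, ℝ × E) y}

lemma IsDynamicEquation.chartField_eq (hγ : IsDynamicEquation π γ) (hψ : IsBundleChart π ψ)
    {z : ℝ × E} (hz : z ∈ ψ.target) : chartField γ ψ z = (1, coordField γ ψ z) := by
  refine Prod.ext ?_ rfl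
  exact (hψ.mfderiv_proj (ψ.map_target hz) _).symm.trans (hγ.dt_eq_one _)

lemma IsDynamicEquation.contDiffOn_chartField (hγ : IsDynamicEquation π γ)
    (hψ : IsBundleChart π ψ) : ContDiffOn ℝ ∞ (chartField γ ψ) ψ.target := by
  have h1 : ContMDiffOn 𝓘(ℝ, ℝ × E) 𝓘(ℝ, ℝ × E).tangent ∞
      (fun z => (⟨ψ.symm z, γ (ψ.symm z)⟩ : TangentBundle 𝓘(ℝ, ℝ × E) Y)) ψ.target :=
    hγ.smooth.comp_contMDiffOn (contMDiffOn_symm_of_mem_maximalAtlas hψ.mem_maximalAtlas)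
  have h2 := (contMDiffOn_of_mem_maximalAtlas hψ.mem_maximalAtlas).contMDiffOn_tangentMapWithin
    (m := ∞) (by simp) ψ.open_source.uniqueMDiffOn
  have h3 := (h2.comp h1 fun z hz => ψ.map_target hz)
  have h4 := (contMDiff_snd_tangentBundle_modelSpace (ℝ × E) 𝓘(ℝ, ℝ × E)
    (n := ∞)).comp_contMDiffOn h3
  refine (contMDiffOn_iff_contDiffOn.1 h4).congr fun z hz => ?_
  exact (DFunLike.congr_fun (mfderivWithin_of_isOpen ψ.open_source (ψ.map_target hz))
    (γ (ψ.symm z))).symm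

end DynEq

namespace DynEq

variable {E : Type*} [NormedAddCommGroup E] [NormedSpace ℝ E]
  {Y : Type*} [TopologicalSpace Y] [ChartedSpace (ℝ × E) Y]
  {π : Y → ℝ} {γ : ∀ y : Y, TangentSpace 𝓘(ℝ, ℝ × E) y}

/-! ### The flow of a complete dynamic equation -/

/-- The flow of a complete dynamic equation on the total space `Y`: `flow hc h y` is reached from
`y` after the time `h` along the trajectory of `y`, hence lies in the fibre over `π y + h`. -/
noncomputable def flow (hc : IsCompleteEquation π γ) (h : ℝ) (y : Y) : Y :=
  Classical.choose (hc y) (π y + h)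

variable (hc : IsCompleteEquation π γ)

lemma flow_zero (y : Y) : flow hc 0 y = y := by
  rw [flow, add_zero]
  exact (Classical.choose_spec (hc y)).2

lemma proj_flow (h : ℝ) (y : Y) : π (flow hc h y) = π y + h :=
  (Classical.choose_spec (hc y)).1.section_eq _

lemma isMIntegralCurve_flow (y : Y) : IsMIntegralCurve (fun h => flow hc h y) γ := by
  have := (Classical.choose_spec (hc y)).1.integralCurve.comp_add (π y)
  simpa only [Function.comp_def, flow, add_comm] using this

lemma continuous_flow_left (y : Y) : Continuous fun h => flow hc h y :=
  continuous_iff_continuousAt.2 fun h => (isMIntegralCurve_flow hc y h).continuousAt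

/-- The squared length of the image under the flow of a tangent vector `v` at `y`, as a function
of the elapsed time. -/
noncomputable def flowSqNorm (g : RiemannianFibreMetric E π) (y : Y)
    (v : TangentSpace 𝓘(ℝ, ℝ × E) y) (h : ℝ) : ℝ :=
  vertEval g.form (flow hc h y) (mfderiv 𝓘(ℝ, ℝ × E) 𝓘(ℝ, ℝ × E) (flow hc h) y v)
    (mfderiv 𝓘(ℝ, ℝ × E) 𝓘(ℝ, ℝ × E) (flow hc h) y v)

lemma flowSqNorm_zero (g : RiemannianFibreMetric E π) (y : Y)
    (v : TangentSpace 𝓘(ℝ, ℝ × E) y) : flowSqNorm hc g y v 0 = vertEval g.form y v v := by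
  have h0 : flow hc 0 = id := funext fun x => flow_zero hc x
  have h1 : mfderiv 𝓘(ℝ, ℝ × E) 𝓘(ℝ, ℝ × E) (flow hc 0) y v = v := by
    rw [h0, mfderiv_id]; rfl
  exact vertEval_congr g.form (flow_zero hc y) h1 h1

variable [IsManifold 𝓘(ℝ, ℝ × E) ∞ Y]

lemma IsDynamicEquation.smooth_one (hγ : IsDynamicEquation π γ) :
    ContMDiff 𝓘(ℝ, ℝ × E) 𝓘(ℝ, ℝ × E).tangent 1
      (fun y => (⟨y, γ y⟩ : TangentBundle 𝓘(ℝ, ℝ × E) Y)) :=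
  hγ.smooth.of_le (by simp)

variable [T2Space Y]

lemma IsSolution.apply_add (hγ : IsDynamicEquation π γ) {s : ℝ → Y}
    (hs : IsSolution π γ s) (t h : ℝ) :
    s (t + h) = flow hc h (s t) := by
  have := isMIntegralCurve_Ioo_eq_of_contMDiff_boundaryless (I := 𝓘(ℝ, ℝ × E)) (t₀ := 0)
    hγ.smooth_one (hs.integralCurve.comp_add t) (isMIntegralCurve_flow hc (s t))
    (by simp [flow_zero])
  have := congrFun this h
  simpa [add_comm] using this

lemma flow_add (hγ : IsDynamicEquation π γ) (h h' : ℝ) (y : Y) :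
    flow hc (h + h') y = flow hc h' (flow hc h y) := by
  have hs := (Classical.choose_spec (hc y)).1
  have := hs.apply_add hc hγ (π y + h) h'
  rw [add_assoc] at this
  exact this

variable [CompleteSpace E]

/-- In a bundle chart the flow for short times is the local flow of the components of `γ`, and its
derivative solves the variational equation. -/
lemma exists_flow_eq_in_chart (hγ : IsDynamicEquation π γ) {ψ : OpenPartialHomeomorph Y (ℝ × E)}
    (hψ : IsBundleChart π ψ) {y : Y} (hy : y ∈ ψ.source) :
    ∃ η > 0, ∃ V ∈ 𝓝 (ψ y), ∃ (α : ℝ × E → ℝ → ℝ × E) (A : ℝ × E → ℝ → ℝ × E →L[ℝ] ℝ × E),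
      IsOpen V ∧
      (∀ z ∈ V, α z 0 = z ∧ A z 0 = ContinuousLinearMap.id ℝ (ℝ × E)) ∧
      (∀ z ∈ V, ∀ h, |h| < η → α z h ∈ ψ.target ∧ HasDerivAt (α z) (chartField γ ψ (α z h)) h ∧
        HasDerivAt (A z) (fderiv ℝ (chartField γ ψ) (α z h) ∘L A z h) h ∧
        HasFDerivAt (fun z' => α z' h) (A z h) z) ∧
      (∀ h, |h| < η → ContinuousOn (fun z => A z h) V) ∧
      ContinuousOn (fun p : (ℝ × E) × ℝ => α p.1 p.2) (V ×ˢ Ioo (-η) η) ∧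
      ∀ z ∈ V, ∀ h, |h| < η → flow hc h (ψ.symm z) = ψ.symm (α z h) := by
  have htgt : ψ.target ∈ 𝓝 (ψ y) := ψ.open_target.mem_nhds (ψ.map_source hy)
  obtain ⟨η, hη, V, hV, α, A, hVo, h0, hder, hA, hcont⟩ := exists_local_flow
    (((hγ.contDiffOn_chartField hψ).contDiffAt htgt).of_le (by norm_cast)) htgt
  refine ⟨η, hη, V, hV, α, A, hVo, h0, hder, hA, hcont, fun z hz h hh => ?_⟩
  have hint : IsMIntegralCurveOn (fun h => ψ.symm (α z h)) γ (Ioo (-η) η) := by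
    intro k hk
    obtain ⟨hmem, hd, -, -⟩ := hder z hz k (abs_lt.2 hk)
    have h1 := (hψ.mdifferentiable.mdifferentiableAt_symm hmem).hasMFDerivAt.comp k
      hd.hasFDerivAt.hasMFDerivAt
    refine h1.hasMFDerivWithinAt.congr_mfderiv ?_
    have := hψ.symm_mfderiv_apply (ψ.map_target hmem) (γ (ψ.symm (α z k)))
    rw [ψ.right_inv hmem] at this
    refine ContinuousLinearMap.ext_ring ?_
    exact (congrArg (mfderiv 𝓘(ℝ, ℝ × E) 𝓘(ℝ, ℝ × E) ψ.symm (α z k)) (one_smul ℝ _)).trans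
      (this.trans (one_smul ℝ (γ (ψ.symm (α z k)))).symm)
  have := isMIntegralCurveOn_Ioo_eqOn_of_contMDiff_boundaryless (I := 𝓘(ℝ, ℝ × E)) (t₀ := 0)
    ⟨by linarith, hη⟩ hγ.smooth_one
    ((isMIntegralCurve_flow hc (ψ.symm z)).isMIntegralCurveOn (Ioo (-η) η)) hint
    (by simp [flow_zero, (h0 z hz).1])
  exact this (abs_lt.1 hh)

/-- Each flow map is continuously differentiable. By the group law, the set of the times at which
this holds at a given point is open and closed. -/
lemma contMDiffAt_flow (hγ : IsDynamicEquation π γ)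
    (hch : ∀ y : Y, ∃ ψ : OpenPartialHomeomorph Y (ℝ × E), IsBundleChart π ψ ∧ y ∈ ψ.source)
    (h : ℝ) (y : Y) :
    ContMDiffAt 𝓘(ℝ, ℝ × E) 𝓘(ℝ, ℝ × E) 1 (flow hc h) y := by
  have hloc : ∀ y : Y, ∃ η > 0, ∃ V ∈ 𝓝 y, ∀ x ∈ V, ∀ h, |h| < η →
      ContMDiffAt 𝓘(ℝ, ℝ × E) 𝓘(ℝ, ℝ × E) 1 (flow hc h) x := by
    intro y
    obtain ⟨ψ, hψ, hy⟩ := hch y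
    obtain ⟨η, hη, V, hV, α, A, hVo, h0, hder, hA, -, hfl⟩ :=
      exists_flow_eq_in_chart hc hγ hψ hy
    refine ⟨η, hη, _, preimage_chart_mem_nhds hy hV, fun x hx h hh => ?_⟩
    have hVx : V ∈ 𝓝 (ψ x) := hVo.mem_nhds hx.2
    have hα : ContDiffAt ℝ 1 (fun z => α z h) (ψ x) :=
      contDiffAt_one_iff.2 ⟨fun z => A z h, V, hVx, hA h hh, fun z hz => (hder z hz h hh).2.2.2⟩
    have h1 := (contMDiffAt_symm_of_mem_maximalAtlas hψ.mem_maximalAtlas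
      (hder (ψ x) hx.2 h hh).1).of_le (m := 1) (by simp)
    have h2 := (contMDiffAt_of_mem_maximalAtlas hψ.mem_maximalAtlas hx.1).of_le (m := 1) (by simp)
    refine (h1.comp x (hα.contMDiffAt.comp x h2)).congr_of_eventuallyEq ?_
    filter_upwards [preimage_chart_mem_nhds hx.1 hVx] with w hw
    have := hfl (ψ w) hw.2 h hh
    rwa [ψ.left_inv hw.1] at this
  -- the property passes between nearby times, as `flow h' = flow (h' - h) ∘ flow h`
  have hprop : ∀ h₀ : ℝ, ∃ T ∈ 𝓝 h₀, ∀ h ∈ T, ∀ h' ∈ T,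
      ContMDiffAt 𝓘(ℝ, ℝ × E) 𝓘(ℝ, ℝ × E) 1 (flow hc h) y →
      ContMDiffAt 𝓘(ℝ, ℝ × E) 𝓘(ℝ, ℝ × E) 1 (flow hc h') y := by
    intro h₀
    obtain ⟨η, hη, V, hV, hsm⟩ := hloc (flow hc h₀ y)
    refine ⟨_, Filter.inter_mem (Metric.ball_mem_nhds h₀ (half_pos hη))
      ((continuous_flow_left hc y).continuousAt hV), fun h hh h' hh' H => ?_⟩
    have hlt : |h' - h| < η := by
      have h1 := abs_lt.1 (Real.dist_eq h h₀ ▸ Metric.mem_ball.1 hh.1)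
      have h2 := abs_lt.1 (Real.dist_eq h' h₀ ▸ Metric.mem_ball.1 hh'.1)
      rw [abs_lt]; constructor <;> linarith
    have heq : flow hc h' = flow hc (h' - h) ∘ flow hc h := by
      funext x
      rw [Function.comp_apply, ← flow_add hc hγ, add_sub_cancel]
    rw [heq]
    exact (hsm _ hh.2 _ hlt).comp y H
  have hclopen : IsClopen {h | ContMDiffAt 𝓘(ℝ, ℝ × E) 𝓘(ℝ, ℝ × E) 1 (flow hc h) y} := by
    constructor
    · rw [← isOpen_compl_iff, isOpen_iff_mem_nhds]
      intro h₀ hh₀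
      obtain ⟨T, hT, hTs⟩ := hprop h₀
      exact Filter.mem_of_superset hT fun h hh H => hh₀ (hTs h hh h₀ (mem_of_mem_nhds hT) H)
    · rw [isOpen_iff_mem_nhds]
      intro h₀ hh₀
      obtain ⟨T, hT, hTs⟩ := hprop h₀
      exact Filter.mem_of_superset hT fun h hh => hTs h₀ (mem_of_mem_nhds hT) h hh hh₀
  have huniv := hclopen.eq_univ ⟨0, by
    have : flow hc 0 = id := funext fun x => flow_zero hc x
    simp only [mem_ofPred_eq, this]
    exact contMDiffAt_id⟩
  exact eq_univ_iff_forall.1 huniv h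

/-- The flow is jointly continuous in time and space. -/
lemma continuous_flow (hγ : IsDynamicEquation π γ)
    (hch : ∀ y : Y, ∃ ψ : OpenPartialHomeomorph Y (ℝ × E), IsBundleChart π ψ ∧ y ∈ ψ.source) :
    Continuous fun p : ℝ × Y => flow hc p.1 p.2 := by
  have hloc : ∀ y : Y, ContinuousAt (fun p : ℝ × Y => flow hc p.1 p.2) (0, y) := by
    intro y
    obtain ⟨ψ, hψ, hy⟩ := hch y
    obtain ⟨η, hη, V, hV, α, A, hVo, h0, hder, hA, hcont, hfl⟩ :=
      exists_flow_eq_in_chart hc hγ hψ hy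
    have hα : ContinuousAt (fun p : (ℝ × E) × ℝ => α p.1 p.2) (ψ y, 0) :=
      hcont.continuousAt (prod_mem_nhds hV (Ioo_mem_nhds (by linarith) hη))
    have h1 : ContinuousAt (fun p : ℝ × Y => (ψ p.2, p.1)) (0, y) :=
      ((ψ.continuousAt hy).comp continuousAt_snd).prodMk continuousAt_fst
    have h2 : ContinuousAt (fun p : ℝ × Y => α (ψ p.2) p.1) (0, y) :=
      ContinuousAt.comp (f := fun p : ℝ × Y => (ψ p.2, p.1))
        (g := fun p : (ℝ × E) × ℝ => α p.1 p.2) hα h1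
    have h3 : ContinuousAt (fun p : ℝ × Y => ψ.symm (α (ψ p.2) p.1)) (0, y) := by
      refine ContinuousAt.comp (f := fun p : ℝ × Y => α (ψ p.2) p.1) (g := ψ.symm) ?_ h2
      exact ψ.continuousAt_symm (hder _ (mem_of_mem_nhds hV) 0 (by simpa)).1
    refine h3.congr ?_
    filter_upwards [prod_mem_nhds (Ioo_mem_nhds (by linarith : -η < 0) hη)
      (preimage_chart_mem_nhds hy hV)] with p hp
    have := hfl (ψ p.2) hp.2.2 p.1 (abs_lt.2 hp.1)
    rw [ψ.left_inv hp.2.1] at this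
    exact this.symm
  rw [continuous_iff_continuousAt]
  rintro ⟨h₀, y⟩
  have heq : (fun p : ℝ × Y => flow hc p.1 p.2) =
      (fun p : ℝ × Y => flow hc p.1 p.2) ∘ fun p => (p.1 - h₀, flow hc h₀ p.2) := by
    funext p
    simp only [Function.comp_apply]
    rw [← flow_add hc hγ, add_sub_cancel]
  rw [heq]
  refine ContinuousAt.comp ?_ ?_
  · simpa using hloc (flow hc h₀ y)
  · exact (continuousAt_fst.sub continuousAt_const).prodMk
      (ContinuousAt.comp (f := Prod.snd) (g := flow hc h₀)
        (contMDiffAt_flow hc hγ hch h₀ y).continuousAt continuousAt_snd)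

end DynEq

namespace DynEq

variable {E : Type*} [NormedAddCommGroup E] [NormedSpace ℝ E]
  {Y : Type*} [TopologicalSpace Y] [ChartedSpace (ℝ × E) Y]
  {π : Y → ℝ} {γ : ∀ y : Y, TangentSpace 𝓘(ℝ, ℝ × E) y}

/-! ### Local bounds for the metric and the Lyapunov tensor -/

set_option maxSynthPendingDepth 3 in
/-- A continuous bilinear form on a finite-dimensional space which is positive definite is bounded
below by a multiple of the squared norm, uniformly for all nearby forms. -/
lemma eventually_mul_sq_norm_le [FiniteDimensional ℝ E] {X : Type*} [TopologicalSpace X]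
    {G : X → E →L[ℝ] E →L[ℝ] ℝ} {z₀ : X} (hG : ContinuousAt G z₀)
    (hpos : ∀ a, a ≠ 0 → 0 < G z₀ a a) :
    ∃ m > 0, ∀ᶠ z in 𝓝 z₀, ∀ a, m * ‖a‖ ^ 2 ≤ G z a a := by
  have := FiniteDimensional.proper ℝ E
  obtain ⟨m, hm, hmS⟩ := (isCompact_sphere (0 : E) 1).exists_forall_le'
    (f := fun a => G z₀ a a) (by fun_prop : Continuous fun a => G z₀ a a).continuousOn (a := 0)
    fun a ha => hpos a (ne_zero_of_mem_unit_sphere ⟨a, ha⟩)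
  have hbd : ∀ a, m * ‖a‖ ^ 2 ≤ G z₀ a a := fun a => by
    rcases eq_or_ne a 0 with rfl | ha
    · simp
    · have hn : ‖a‖ ≠ 0 := norm_ne_zero_iff.2 ha
      have := hmS (‖a‖⁻¹ • a) (by simp [norm_smul, hn])
      simp only [map_smul, smul_apply, smul_eq_mul] at this
      have h2 := mul_le_mul_of_nonneg_left this (sq_nonneg ‖a‖)
      calc m * ‖a‖ ^ 2 = ‖a‖ ^ 2 * m := mul_comm _ _
        _ ≤ _ := h2
        _ = G z₀ a a := by field_simp
  refine ⟨m / 2, half_pos hm, ?_⟩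
  filter_upwards [hG (Metric.ball_mem_nhds (G z₀) (half_pos hm))] with z hz a
  replace hz : ‖G z - G z₀‖ < m / 2 := mem_ball_iff_norm.1 hz
  have h1 : ‖(G z - G z₀) a a‖ ≤ m / 2 * ‖a‖ ^ 2 := by
    refine ((G z - G z₀).le_opNorm₂ a a).trans ?_
    rw [mul_assoc, ← sq]
    gcongr
  have h2 := (abs_le.1 h1).1
  simp only [sub_apply] at h2
  linarith [hbd a]

set_option maxSynthPendingDepth 3 in
lemma hasDerivAt_bilin_apply {F : Type*} [NormedAddCommGroup F] [NormedSpace ℝ F]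
    {G : F → E →L[ℝ] E →L[ℝ] ℝ} {G' : F →L[ℝ] E →L[ℝ] E →L[ℝ] ℝ} {c : ℝ → F} {c' : F}
    {u : ℝ → E} {u' : E} {t : ℝ} (hG : HasFDerivAt G G' (c t)) (hc : HasDerivAt c c' t)
    (hu : HasDerivAt u u' t) :
    HasDerivAt (fun h => G (c h) (u h) (u h))
      (G' c' (u t) (u t) + G (c t) u' (u t) + G (c t) (u t) u') t :=
  (((hG.comp_hasDerivAt t hc).clm_apply hu).clm_apply hu).congr_deriv (by simp)

/-- The Lyapunov tensor in terms of a family of bilinear forms representing the metric. -/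
lemma covLyapunov_eq (g : RiemannianFibreMetric E π) {ψ : OpenPartialHomeomorph Y (ℝ × E)}
    {G : ℝ × E → E →L[ℝ] E →L[ℝ] ℝ} (hGs : ContDiffOn ℝ ∞ G ψ.target)
    (hG : ∀ z ∈ ψ.target, ∀ a b, coordForm g.form ψ z a b = G z a b) {z : ℝ × E}
    (hz : z ∈ ψ.target) (a b : E) :
    covLyapunov γ g ψ z a b = fderiv ℝ G z (1, coordField γ ψ z) a b
      + G z (fderiv ℝ (coordField γ ψ) z (0, a)) b
      + G z a (fderiv ℝ (coordField γ ψ) z (0, b)) := by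
  have htgt := ψ.open_target.mem_nhds hz
  have h1 : HasFDerivAt G (fderiv ℝ G z) z :=
    ((hGs.contDiffAt htgt).differentiableAt (by simp)).hasFDerivAt
  have h2 : HasFDerivAt (fun z' => coordForm g.form ψ z' a b) _ z :=
    ((h1.clm_apply (hasFDerivAt_const a z)).clm_apply
      (hasFDerivAt_const b z)).congr_of_eventuallyEq
      (by filter_upwards [htgt] with z' hz' using hG z' hz' a b)
  rw [covLyapunov, h2.fderiv, hG z hz, hG z hz]
  simp

/-- The Lyapunov tensor is at most `K` times the metric at `y`. As in `LyapunovNegDefAt`, this is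
required in some bundle chart around `y`. -/
def LyapunovLeAt (γ : ∀ y : Y, TangentSpace 𝓘(ℝ, ℝ × E) y) (g : RiemannianFibreMetric E π)
    (K : ℝ) (y : Y) : Prop :=
  ∃ ψ : OpenPartialHomeomorph Y (ℝ × E), IsBundleChart π ψ ∧ y ∈ ψ.source ∧
    ∀ a : E, covLyapunov γ g ψ (ψ y) a a ≤ K * coordForm g.form ψ (ψ y) a a

lemma LyapunovLeAt.mono {g : RiemannianFibreMetric E π} {K K' : ℝ} {y : Y}
    (h : LyapunovLeAt γ g K y) (hK : K ≤ K') : LyapunovLeAt γ g K' y := by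
  obtain ⟨ψ, hψ, hy, hle⟩ := h
  refine ⟨ψ, hψ, hy, fun a => (hle a).trans ?_⟩
  gcongr
  exact vertEval_self_nonneg g _ _

variable [IsManifold 𝓘(ℝ, ℝ × E) ∞ Y]

/-- Near each point of a bundle chart, the metric is bounded below by a multiple of the coordinate
norm. -/
lemma IsBundleChart.eventually_mul_sq_norm_le_coordForm [FiniteDimensional ℝ E]
    {ψ : OpenPartialHomeomorph Y (ℝ × E)} (hψ : IsBundleChart π ψ)
    (g : RiemannianFibreMetric E π) {z₀ : ℝ × E} (hz₀ : z₀ ∈ ψ.target) :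
    ∃ m > 0, ∀ᶠ z in 𝓝 z₀, z ∈ ψ.target ∧ ∀ a, m * ‖a‖ ^ 2 ≤ coordForm g.form ψ z a a := by
  obtain ⟨G, hGs, hG⟩ := hψ.exists_coordForm_eq g
  have htgt := ψ.open_target.mem_nhds hz₀
  obtain ⟨m, hm, hev⟩ := eventually_mul_sq_norm_le (hGs.contDiffAt htgt).continuousAt
    fun a ha => (hG z₀ hz₀ a a).symm ▸ hψ.coordForm_pos g hz₀ ha
  refine ⟨m, hm, ?_⟩
  filter_upwards [htgt, hev] with z hz h
  exact ⟨hz, fun a => (hG z hz a a).symm ▸ h a⟩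

lemma IsDynamicEquation.contDiffOn_coordField (hγ : IsDynamicEquation π γ)
    {ψ : OpenPartialHomeomorph Y (ℝ × E)} (hψ : IsBundleChart π ψ) :
    ContDiffOn ℝ ∞ (coordField γ ψ) ψ.target :=
  (hγ.contDiffOn_chartField hψ).snd

lemma LyapunovNegDefAt.lyapunovLeAt_zero [FiniteDimensional ℝ E] {g : RiemannianFibreMetric E π}
    {y : Y} (h : LyapunovNegDefAt γ g y) : LyapunovLeAt γ g 0 y := by
  obtain ⟨ψ, hψ, hy, hneg⟩ := h
  refine ⟨ψ, hψ, hy, fun a => ?_⟩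
  rw [zero_mul]
  rcases eq_or_ne a 0 with rfl | ha
  · obtain ⟨G, hGs, hG⟩ := hψ.exists_coordForm_eq g
    rw [covLyapunov_eq g hGs hG (ψ.map_source hy)]
    simp
  · exact (hneg a ha).le

set_option maxSynthPendingDepth 3 in
lemma exists_eventually_lyapunovLeAt [FiniteDimensional ℝ E] (hγ : IsDynamicEquation π γ)
    (g : RiemannianFibreMetric E π) {ψ : OpenPartialHomeomorph Y (ℝ × E)}
    (hψ : IsBundleChart π ψ) {y : Y} (hy : y ∈ ψ.source) :
    ∃ K, ∀ᶠ x in 𝓝 y, LyapunovLeAt γ g K x := by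
  obtain ⟨G, hGs, hG⟩ := hψ.exists_coordForm_eq g
  have hz₀ := ψ.map_source hy
  have htgt := ψ.open_target.mem_nhds hz₀
  obtain ⟨m, hm, hev⟩ := hψ.eventually_mul_sq_norm_le_coordForm g hz₀
  set b : ℝ × E → ℝ := fun z => ‖fderiv ℝ G z (1, coordField γ ψ z)‖ +
    2 * (‖G z‖ * ‖fderiv ℝ (coordField γ ψ) z‖) with hb
  have hb0 : 0 ≤ b (ψ y) := by positivity
  have hbc : ContinuousAt b (ψ y) := by
    have h1 := (hGs.contDiffAt htgt)
    have h2 := ((hγ.contDiffOn_coordField hψ).contDiffAt htgt)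
    have h3 : ContinuousAt (fderiv ℝ G) (ψ y) := (h1.fderiv_right (m := 0) (by simp)).continuousAt
    have h4 : ContinuousAt (fderiv ℝ (coordField γ ψ)) (ψ y) :=
      (h2.fderiv_right (m := 0) (by simp)).continuousAt
    exact (h3.clm_apply (continuousAt_const.prodMk h2.continuousAt)).norm.add
      (continuousAt_const.mul (h1.continuousAt.norm.mul h4.norm))
  have hbev : ∀ᶠ z in 𝓝 (ψ y), b z < b (ψ y) + 1 :=
    hbc.eventually_lt continuousAt_const (by simp)
  refine ⟨(b (ψ y) + 1) / m, ?_⟩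
  filter_upwards [ψ.open_source.mem_nhds hy, (ψ.continuousAt hy).eventually (hev.and hbev)]
    with x hx ⟨⟨hxt, hlow⟩, hup⟩
  refine ⟨ψ, hψ, hx, fun a => ?_⟩
  have hcov : covLyapunov γ g ψ (ψ x) a a ≤ b (ψ x) * ‖a‖ ^ 2 := by
    rw [covLyapunov_eq g hGs hG hxt]
    have hD : ‖fderiv ℝ (coordField γ ψ) (ψ x) (0, a)‖ ≤
        ‖fderiv ℝ (coordField γ ψ) (ψ x)‖ * ‖a‖ := by
      simpa using (fderiv ℝ (coordField γ ψ) (ψ x)).le_opNorm (0, a)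
    have e1 := (le_abs_self _).trans
      ((fderiv ℝ G (ψ x) (1, coordField γ ψ (ψ x))).le_opNorm₂ a a)
    have e2 := (le_abs_self _).trans
      ((G (ψ x)).le_opNorm₂ (fderiv ℝ (coordField γ ψ) (ψ x) (0, a)) a)
    have e3 := (le_abs_self _).trans
      ((G (ψ x)).le_opNorm₂ a (fderiv ℝ (coordField γ ψ) (ψ x) (0, a)))
    have e4 : ‖G (ψ x)‖ * ‖fderiv ℝ (coordField γ ψ) (ψ x) (0, a)‖ * ‖a‖ ≤
        ‖G (ψ x)‖ * (‖fderiv ℝ (coordField γ ψ) (ψ x)‖ * ‖a‖) * ‖a‖ := by gcongr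
    simp only [hb]
    linarith
  calc covLyapunov γ g ψ (ψ x) a a ≤ b (ψ x) * ‖a‖ ^ 2 := hcov
    _ ≤ (b (ψ y) + 1) * ‖a‖ ^ 2 := by gcongr
    _ = (b (ψ y) + 1) / m * (m * ‖a‖ ^ 2) := by field_simp
    _ ≤ _ := by gcongr; exact hlow a

/-- On a neighbourhood of a compact set the Lyapunov tensor is bounded by a multiple of the
metric. -/
lemma exists_isOpen_lyapunovLeAt_of_isCompact [FiniteDimensional ℝ E] (hγ : IsDynamicEquation π γ)
    (hch : ∀ y : Y, ∃ ψ : OpenPartialHomeomorph Y (ℝ × E), IsBundleChart π ψ ∧ y ∈ ψ.source)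
    (g : RiemannianFibreMetric E π) {C : Set Y} (hC : IsCompact C) :
    ∃ K, ∃ N, IsOpen N ∧ C ⊆ N ∧ ∀ x ∈ N, LyapunovLeAt γ g K x := by
  refine hC.induction_on (p := fun C => ∃ K, ∃ N, IsOpen N ∧ C ⊆ N ∧ ∀ x ∈ N,
    LyapunovLeAt γ g K x) ⟨0, ∅, isOpen_empty, Subset.rfl, by simp⟩ ?_ ?_ ?_
  · rintro C C' hCC' ⟨K, N, hN, hCN, h⟩
    exact ⟨K, N, hN, hCC'.trans hCN, h⟩
  · rintro C C' ⟨K, N, hN, hCN, h⟩ ⟨K', N', hN', hCN', h'⟩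
    refine ⟨max K K', N ∪ N', hN.union hN', union_subset_union hCN hCN', ?_⟩
    rintro x (hx | hx)
    exacts [(h x hx).mono (le_max_left _ _), (h' x hx).mono (le_max_right _ _)]
  · intro y _
    obtain ⟨ψ, hψ, hy⟩ := hch y
    obtain ⟨K, hK⟩ := exists_eventually_lyapunovLeAt hγ g hψ hy
    obtain ⟨N, hNs, hN, hyN⟩ := mem_nhds_iff.1 hK
    exact ⟨N, mem_nhdsWithin_of_mem_nhds (hN.mem_nhds hyN), K, N, hN, Subset.rfl,
      fun x hx => hNs hx⟩

/-! ### Evolution of vertical vectors along the flow -/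

variable [T2Space Y] [CompleteSpace E] (hc : IsCompleteEquation π γ)

lemma mdifferentiableAt_flow (hγ : IsDynamicEquation π γ)
    (hch : ∀ y : Y, ∃ ψ : OpenPartialHomeomorph Y (ℝ × E), IsBundleChart π ψ ∧ y ∈ ψ.source)
    (h : ℝ) (y : Y) : MDifferentiableAt 𝓘(ℝ, ℝ × E) 𝓘(ℝ, ℝ × E) (flow hc h) y :=
  (contMDiffAt_flow hc hγ hch h y).mdifferentiableAt (by simp)

/-- The flow maps fibres to fibres, hence preserves vertical vectors. -/
lemma mfderiv_flow_mem_vert (hγ : IsDynamicEquation π γ)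
    (hch : ∀ y : Y, ∃ ψ : OpenPartialHomeomorph Y (ℝ × E), IsBundleChart π ψ ∧ y ∈ ψ.source)
    (hπ : MDifferentiable 𝓘(ℝ, ℝ × E) 𝓘(ℝ, ℝ) π) (h : ℝ) {y : Y}
    {v : TangentSpace 𝓘(ℝ, ℝ × E) y} (hv : v ∈ Vert E π y) :
    mfderiv 𝓘(ℝ, ℝ × E) 𝓘(ℝ, ℝ × E) (flow hc h) y v ∈ Vert E π (flow hc h y) := by
  have h1 := (hπ (flow hc h y)).hasMFDerivAt.comp y
    (mdifferentiableAt_flow hc hγ hch h y).hasMFDerivAt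
  have h2 := ((hasFDerivAt_id (𝕜 := ℝ) (π y)).add_const h).hasMFDerivAt.comp y
    (hπ y).hasMFDerivAt
  have heq : π ∘ flow hc h = (fun t => id t + h) ∘ π := funext fun x => proj_flow hc h x
  rw [heq] at h1
  have h3 := DFunLike.congr_fun (hasMFDerivAt_unique h1 h2) v
  have h4 : mfderiv 𝓘(ℝ, ℝ × E) 𝓘(ℝ, ℝ) π y v = 0 := LinearMap.mem_ker.1 hv
  exact LinearMap.mem_ker.2 (h3.trans h4)

lemma mfderiv_flow_add (hγ : IsDynamicEquation π γ)
    (hch : ∀ y : Y, ∃ ψ : OpenPartialHomeomorph Y (ℝ × E), IsBundleChart π ψ ∧ y ∈ ψ.source)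
    (h k : ℝ) (y : Y) (v : TangentSpace 𝓘(ℝ, ℝ × E) y) :
    mfderiv 𝓘(ℝ, ℝ × E) 𝓘(ℝ, ℝ × E) (flow hc (h + k)) y v =
      mfderiv 𝓘(ℝ, ℝ × E) 𝓘(ℝ, ℝ × E) (flow hc k) (flow hc h y)
        (mfderiv 𝓘(ℝ, ℝ × E) 𝓘(ℝ, ℝ × E) (flow hc h) y v) := by
  have heq : flow hc (h + k) = flow hc k ∘ flow hc h := funext fun x => flow_add hc hγ h k x
  have := ((mdifferentiableAt_flow hc hγ hch k (flow hc h y)).hasMFDerivAt.comp y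
    (mdifferentiableAt_flow hc hγ hch h y).hasMFDerivAt).mfderiv
  rw [heq, this]
  rfl

lemma flowSqNorm_add (hγ : IsDynamicEquation π γ)
    (hch : ∀ y : Y, ∃ ψ : OpenPartialHomeomorph Y (ℝ × E), IsBundleChart π ψ ∧ y ∈ ψ.source)
    (g : RiemannianFibreMetric E π) (y : Y) (v : TangentSpace 𝓘(ℝ, ℝ × E) y) (h k : ℝ) :
    flowSqNorm hc g y v (h + k) = flowSqNorm hc g (flow hc h y)
      (mfderiv 𝓘(ℝ, ℝ × E) 𝓘(ℝ, ℝ × E) (flow hc h) y v) k :=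
  vertEval_congr g.form (flow_add hc hγ h k y) (mfderiv_flow_add hc hγ hch h k y v)
    (mfderiv_flow_add hc hγ hch h k y v)

/-- The Lyapunov tensor is the rate of change of the squared lengths of vertical vectors carried
along by the flow. -/
lemma hasDerivAt_flowSqNorm_zero [FiniteDimensional ℝ E] (hγ : IsDynamicEquation π γ)
    (hch : ∀ y : Y, ∃ ψ : OpenPartialHomeomorph Y (ℝ × E), IsBundleChart π ψ ∧ y ∈ ψ.source)
    (hπ : MDifferentiable 𝓘(ℝ, ℝ × E) 𝓘(ℝ, ℝ) π)
    (g : RiemannianFibreMetric E π) {ψ : OpenPartialHomeomorph Y (ℝ × E)}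
    (hψ : IsBundleChart π ψ) {y : Y} (hy : y ∈ ψ.source)
    {v : TangentSpace 𝓘(ℝ, ℝ × E) y} (hv : v ∈ Vert E π y) :
    HasDerivAt (flowSqNorm hc g y v) (covLyapunov γ g ψ (ψ y)
      (Prod.snd (α := ℝ) (β := E) (mfderiv 𝓘(ℝ, ℝ × E) 𝓘(ℝ, ℝ × E) ψ y v))
      (Prod.snd (α := ℝ) (β := E) (mfderiv 𝓘(ℝ, ℝ × E) 𝓘(ℝ, ℝ × E) ψ y v))) 0 := by
  obtain ⟨G, hGs, hG⟩ := hψ.exists_coordForm_eq g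
  obtain ⟨η, hη, V, hV, α, A, hVo, h0, hder, -, -, hfl⟩ :=
    exists_flow_eq_in_chart hc hγ hψ hy
  have hyV := mem_of_mem_nhds hV
  have hz₀ := ψ.map_source hy
  have htgt := ψ.open_target.mem_nhds hz₀
  obtain ⟨a, ha⟩ : ∃ a : E, a = Prod.snd (α := ℝ) (β := E)
    (mfderiv 𝓘(ℝ, ℝ × E) 𝓘(ℝ, ℝ × E) ψ y v) := ⟨_, rfl⟩
  have hva : mfderiv 𝓘(ℝ, ℝ × E) 𝓘(ℝ, ℝ × E) ψ y v = ((0, a) : ℝ × E) :=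
    Prod.ext ((hψ.mem_vert_iff hy v).1 hv) ha.symm
  rw [← ha]
  set z₀ := ψ y with hz₀def
  -- in the chart, the image of `v` has the components `A z₀ h (0, a)`
  have hloc : ∀ h, |h| < η → flowSqNorm hc g y v h =
      G (α z₀ h) (A z₀ h (0, a)).2 (A z₀ h (0, a)).2 := by
    intro h hh
    obtain ⟨hαt, -, -, hαA⟩ := hder z₀ hyV h hh
    have hfy : flow hc h y = ψ.symm (α z₀ h) := by
      have := hfl z₀ hyV h hh
      rwa [hz₀def, ψ.left_inv hy] at this
    have hfs : flow hc h y ∈ ψ.source := hfy ▸ ψ.map_target hαt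
    have hψf : ψ (flow hc h y) = α z₀ h := by rw [hfy, ψ.right_inv hαt]
    have e1 := (hψ.mdifferentiable.mdifferentiableAt hfs).hasMFDerivAt.comp y
      (mdifferentiableAt_flow hc hγ hch h y).hasMFDerivAt
    have e2 := hαA.hasMFDerivAt.comp y (hψ.mdifferentiable.mdifferentiableAt hy).hasMFDerivAt
    have heq : (ψ ∘ flow hc h) =ᶠ[𝓝 y] ((fun z => α z h) ∘ ψ) := by
      filter_upwards [preimage_chart_mem_nhds hy hV] with x hx
      have := hfl (ψ x) hx.2 h hh
      rw [ψ.left_inv hx.1] at this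
      simp only [Function.comp_apply]
      rw [this, ψ.right_inv (hder _ hx.2 h hh).1]
    have e3 := DFunLike.congr_fun (hasMFDerivAt_unique e1 (e2.congr_of_eventuallyEq heq)) v
    have e4 : mfderiv 𝓘(ℝ, ℝ × E) 𝓘(ℝ, ℝ × E) ψ (flow hc h y)
        (mfderiv 𝓘(ℝ, ℝ × E) 𝓘(ℝ, ℝ × E) (flow hc h) y v) = A z₀ h (0, a) :=
      e3.trans (congrArg (A z₀ h) hva)
    have hvert := mfderiv_flow_mem_vert hc hγ hch hπ h hv
    rw [flowSqNorm, hψ.vertEval_eq_coordForm g.form hfs hvert hvert, e4, hψf, hG _ hαt]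
  obtain ⟨-, hα, hA, -⟩ := hder z₀ hyV 0 (by simpa)
  rw [(h0 z₀ hyV).1] at hα hA
  rw [(h0 z₀ hyV).2] at hA
  have hGd : HasFDerivAt G (fderiv ℝ G z₀) (α z₀ 0) := by
    rw [(h0 z₀ hyV).1]
    exact ((hGs.contDiffAt htgt).differentiableAt (by simp)).hasFDerivAt
  have hX : HasFDerivAt (chartField γ ψ) (fderiv ℝ (chartField γ ψ) z₀) z₀ :=
    (((hγ.contDiffOn_chartField hψ).contDiffAt htgt).differentiableAt (by simp)).hasFDerivAt
  have hXs : fderiv ℝ (coordField γ ψ) z₀ (0, a) = (fderiv ℝ (chartField γ ψ) z₀ (0, a)).2 := by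
    have : fderiv ℝ (coordField γ ψ) z₀ = _ := hX.snd.fderiv
    rw [this]; rfl
  have hu : HasDerivAt (fun h => (A z₀ h (0, a)).2) (fderiv ℝ (coordField γ ψ) z₀ (0, a)) 0 := by
    rw [hXs]
    have := (ContinuousLinearMap.snd ℝ ℝ E).hasFDerivAt.comp_hasDerivAt (0 : ℝ)
      (hA.clm_apply (hasDerivAt_const (0 : ℝ) ((0, a) : ℝ × E)))
    simpa [Function.comp_def] using this
  have hfin := (hasDerivAt_bilin_apply hGd hα hu).congr_of_eventuallyEq
    (f₁ := flowSqNorm hc g y v) (by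
      filter_upwards [Ioo_mem_nhds (by linarith : -η < 0) hη] with h hh
      exact hloc h (abs_lt.2 hh))
  refine hfin.congr_deriv ?_
  rw [covLyapunov_eq g hGs hG hz₀, (h0 z₀ hyV).1, (h0 z₀ hyV).2, hγ.chartField_eq hψ hz₀]
  rfl

lemma exists_hasDerivAt_flowSqNorm [FiniteDimensional ℝ E] (hγ : IsDynamicEquation π γ)
    (hch : ∀ y : Y, ∃ ψ : OpenPartialHomeomorph Y (ℝ × E), IsBundleChart π ψ ∧ y ∈ ψ.source)
    (hπ : MDifferentiable 𝓘(ℝ, ℝ × E) 𝓘(ℝ, ℝ) π)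
    (g : RiemannianFibreMetric E π) {y : Y} {v : TangentSpace 𝓘(ℝ, ℝ × E) y}
    (hv : v ∈ Vert E π y) {h K : ℝ} (hK : LyapunovLeAt γ g K (flow hc h y)) :
    ∃ q', HasDerivAt (flowSqNorm hc g y v) q' h ∧ q' ≤ K * flowSqNorm hc g y v h := by
  obtain ⟨ψ, hψ, hs, hle⟩ := hK
  have hvert := mfderiv_flow_mem_vert hc hγ hch hπ h hv
  have h1 := hasDerivAt_flowSqNorm_zero hc hγ hch hπ g hψ hs hvert
  rw [← sub_self h] at h1
  refine ⟨_, (h1.comp_sub_const h h).congr_of_eventuallyEq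
    (Filter.Eventually.of_forall fun k => ?_), (hle _).trans (le_of_eq ?_)⟩
  · have := flowSqNorm_add hc hγ hch g y v h (k - h)
    rwa [add_sub_cancel] at this
  · rw [← hψ.vertEval_eq_coordForm g.form hs hvert hvert]
    rfl

/-- If the Lyapunov tensor is at most `K` times the metric along a piece of a trajectory, then
the flow expands squared lengths of vertical vectors at most at the exponential rate `K`. -/
lemma flowSqNorm_le_exp_mul [FiniteDimensional ℝ E] (hγ : IsDynamicEquation π γ)
    (hch : ∀ y : Y, ∃ ψ : OpenPartialHomeomorph Y (ℝ × E), IsBundleChart π ψ ∧ y ∈ ψ.source)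
    (hπ : MDifferentiable 𝓘(ℝ, ℝ × E) 𝓘(ℝ, ℝ) π)
    (g : RiemannianFibreMetric E π) {y : Y} {v : TangentSpace 𝓘(ℝ, ℝ × E) y}
    (hv : v ∈ Vert E π y) {h₀ h₁ K : ℝ} (h₀₁ : h₀ ≤ h₁)
    (hK : ∀ h ∈ Icc h₀ h₁, LyapunovLeAt γ g K (flow hc h y)) :
    flowSqNorm hc g y v h₁ ≤ Real.exp (K * (h₁ - h₀)) * flowSqNorm hc g y v h₀ := by
  choose! q' hq' hle using fun h (hh : h ∈ Icc h₀ h₁) =>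
    exists_hasDerivAt_flowSqNorm hc hγ hch hπ g hv (hK h hh)
  have hder : ∀ h ∈ Icc h₀ h₁, HasDerivAt
      (fun h => Real.exp (-(K * h)) * flowSqNorm hc g y v h)
      (Real.exp (-(K * h)) * (q' h - K * flowSqNorm hc g y v h)) h := fun h hh => by
    have h1 : HasDerivAt (fun h => -(K * h)) (-K) h := by
      simpa using ((hasDerivAt_id h).const_mul K).fun_neg
    exact (h1.exp.mul (hq' h hh)).congr_deriv (by ring)
  have hanti : AntitoneOn (fun h => Real.exp (-(K * h)) * flowSqNorm hc g y v h)
      (Icc h₀ h₁) := by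
    refine antitoneOn_of_hasDerivWithinAt_nonpos (convex_Icc _ _)
      (fun h hh => (hder h hh).continuousAt.continuousWithinAt)
      (fun h hh => (hder h (interior_subset hh)).hasDerivWithinAt) fun h hh => ?_
    exact mul_nonpos_of_nonneg_of_nonpos (Real.exp_pos _).le
      (sub_nonpos.2 (hle h (interior_subset hh)))
  have := hanti (left_mem_Icc.2 h₀₁) (right_mem_Icc.2 h₀₁) h₀₁
  have h2 := mul_le_mul_of_nonneg_left this (Real.exp_pos (K * h₁)).le
  simp only [← mul_assoc, ← Real.exp_add] at h2
  rwa [add_neg_cancel, Real.exp_zero, one_mul, ← sub_eq_add_neg, ← mul_sub] at h2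

end DynEq

namespace DynEq

variable {E : Type*} [NormedAddCommGroup E] [NormedSpace ℝ E]
  {Y : Type*} [TopologicalSpace Y] [ChartedSpace (ℝ × E) Y]
  {π : Y → ℝ} {γ : ∀ y : Y, TangentSpace 𝓘(ℝ, ℝ × E) y}

/-! ### Curves in the fibres -/

lemma uniqueMDiffWithinAt_unitInterval {τ : ℝ} (hτ : τ ∈ Icc (0 : ℝ) 1) :
    UniqueMDiffWithinAt 𝓘(ℝ, ℝ) (Icc (0 : ℝ) 1) τ :=
  (uniqueDiffOn_Icc zero_lt_one τ hτ).uniqueMDiffWithinAt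

/-- The velocity of a curve `c : [0, 1] → Y`, one-sided at the end points. -/
noncomputable abbrev velocity (c : ℝ → Y) (τ : ℝ) : TangentSpace 𝓘(ℝ, ℝ × E) (c τ) :=
  mfderivWithin 𝓘(ℝ, ℝ) 𝓘(ℝ, ℝ × E) c (Icc 0 1) τ (1 : ℝ)

lemma hasMFDerivWithinAt_of_contMDiffOn {c : ℝ → Y}
    (hc : ContMDiffOn 𝓘(ℝ, ℝ) 𝓘(ℝ, ℝ × E) 1 c (Icc 0 1)) {τ : ℝ} (hτ : τ ∈ Icc (0 : ℝ) 1) :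
    HasMFDerivWithinAt 𝓘(ℝ, ℝ) 𝓘(ℝ, ℝ × E) c (Icc 0 1) τ
      (mfderivWithin 𝓘(ℝ, ℝ) 𝓘(ℝ, ℝ × E) c (Icc 0 1) τ) :=
  ((hc τ hτ).mdifferentiableWithinAt (by simp)).hasMFDerivWithinAt

lemma velocity_mem_vert (hπ : MDifferentiable 𝓘(ℝ, ℝ × E) 𝓘(ℝ, ℝ) π) {c : ℝ → Y} {t : ℝ}
    (hc : ContMDiffOn 𝓘(ℝ, ℝ) 𝓘(ℝ, ℝ × E) 1 c (Icc 0 1))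
    (hct : ∀ τ ∈ Icc (0 : ℝ) 1, π (c τ) = t) {τ : ℝ} (hτ : τ ∈ Icc (0 : ℝ) 1) :
    velocity c τ ∈ Vert E π (c τ) := by
  have h1 := (hπ (c τ)).hasMFDerivAt.comp_hasMFDerivWithinAt τ
    (hasMFDerivWithinAt_of_contMDiffOn hc hτ)
  have h2 : HasMFDerivWithinAt 𝓘(ℝ, ℝ) 𝓘(ℝ, ℝ) (π ∘ c) (Icc 0 1) τ 0 :=
    (hasMFDerivWithinAt_const t (Icc (0 : ℝ) 1) τ).congr_of_eventuallyEq
      (Filter.eventually_of_mem self_mem_nhdsWithin hct) (hct τ hτ)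
  exact LinearMap.mem_ker.2 (DFunLike.congr_fun
    ((uniqueMDiffWithinAt_unitInterval hτ).eq h1 h2) (1 : ℝ))

variable [IsManifold 𝓘(ℝ, ℝ × E) ∞ Y]

/-- As long as a curve in a fibre stays in the part of a bundle chart where the metric is at least
`m` times the squared norm, the coordinate distance it covers is at most `1 / √m` times its
length. -/
lemma mul_enorm_sub_le_fibreLength (hπ : MDifferentiable 𝓘(ℝ, ℝ × E) 𝓘(ℝ, ℝ) π)
    (g : RiemannianFibreMetric E π) {ψ : OpenPartialHomeomorph Y (ℝ × E)}
    (hψ : IsBundleChart π ψ) {m : ℝ} (hm : 0 ≤ m) {c : ℝ → Y} {t b : ℝ}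
    (hc : ContMDiffOn 𝓘(ℝ, ℝ) 𝓘(ℝ, ℝ × E) 1 c (Icc 0 1))
    (hct : ∀ τ ∈ Icc (0 : ℝ) 1, π (c τ) = t) (hb : b ∈ Icc (0 : ℝ) 1)
    (hcψ : ∀ τ ∈ Icc 0 b, c τ ∈ ψ.source ∧
      ∀ a, m * ‖a‖ ^ 2 ≤ coordForm g.form ψ (ψ (c τ)) a a) :
    ENNReal.ofReal (Real.sqrt m) * ‖ψ (c b) - ψ (c 0)‖ₑ ≤ fibreLength g c := by
  have hsub : Icc 0 b ⊆ Icc (0 : ℝ) 1 := Icc_subset_Icc_right hb.2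
  have hu : ContDiffOn ℝ 1 (ψ ∘ c) (Icc 0 b) := by
    rw [← contMDiffOn_iff_contDiffOn]
    exact ((contMDiffOn_of_mem_maximalAtlas hψ.mem_maximalAtlas).of_le (by simp)).comp
      (hc.mono hsub) fun τ hτ => (hcψ τ hτ).1
  have hspeed : ∀ τ ∈ Ioo 0 b, ENNReal.ofReal (Real.sqrt m) * ‖deriv (ψ ∘ c) τ‖ₑ ≤
      ENNReal.ofReal (Real.sqrt (vertEval g.form (c τ) (velocity c τ) (velocity c τ))) := by
    intro τ hτ
    have hτb := Ioo_subset_Icc_self hτ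
    have hτ1 := hsub hτb
    obtain ⟨hs, hlow⟩ := hcψ τ hτb
    have h1 := (hψ.mdifferentiable.mdifferentiableAt hs).hasMFDerivAt.comp_hasMFDerivWithinAt τ
      (hasMFDerivWithinAt_of_contMDiffOn hc hτ1)
    obtain ⟨L, hL⟩ : ∃ L : ℝ →L[ℝ] ℝ × E, L = (mfderiv 𝓘(ℝ, ℝ × E) 𝓘(ℝ, ℝ × E) ψ (c τ)).comp
        (mfderivWithin 𝓘(ℝ, ℝ) 𝓘(ℝ, ℝ × E) c (Icc 0 1) τ) := ⟨_, rfl⟩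
    replace h1 : HasMFDerivWithinAt 𝓘(ℝ, ℝ) 𝓘(ℝ, ℝ × E) (ψ ∘ c) (Icc 0 1) τ L := hL ▸ h1
    have h1' : HasFDerivWithinAt (ψ ∘ c) L (Icc (0 : ℝ) 1) τ := h1.hasFDerivWithinAt
    have hL1 : L 1 = mfderiv 𝓘(ℝ, ℝ × E) 𝓘(ℝ, ℝ × E) ψ (c τ) (velocity c τ) := by rw [hL]; rfl
    have h2 : HasDerivAt (ψ ∘ c) (mfderiv 𝓘(ℝ, ℝ × E) 𝓘(ℝ, ℝ × E) ψ (c τ) (velocity c τ)) τ :=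
      hL1 ▸ (h1'.hasFDerivAt (Icc_mem_nhds hτ.1 (hτ.2.trans_le hb.2))).hasDerivAt
    have hv := velocity_mem_vert hπ hc hct hτ1
    have h3 := (hψ.mem_vert_iff hs _).1 hv
    obtain ⟨a, ha⟩ : ∃ a : E, a = Prod.snd (α := ℝ) (β := E)
      (mfderiv 𝓘(ℝ, ℝ × E) 𝓘(ℝ, ℝ × E) ψ (c τ) (velocity c τ)) := ⟨_, rfl⟩
    have h4 : deriv (ψ ∘ c) τ = ((0, a) : ℝ × E) := h2.deriv.trans (Prod.ext h3 ha.symm)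
    have h5 : ‖((0, a) : ℝ × E)‖ₑ = ENNReal.ofReal ‖a‖ := by
      rw [← ofReal_norm]; simp
    rw [h4, h5, ← ENNReal.ofReal_mul (Real.sqrt_nonneg _),
      hψ.vertEval_eq_coordForm g.form hs hv hv, ← ha]
    refine ENNReal.ofReal_le_ofReal (Real.le_sqrt_of_sq_le ?_)
    rw [mul_pow, Real.sq_sqrt hm]
    exact hlow a
  calc ENNReal.ofReal (Real.sqrt m) * ‖ψ (c b) - ψ (c 0)‖ₑ
      ≤ ENNReal.ofReal (Real.sqrt m) * ∫⁻ τ in Icc 0 b, ‖deriv (ψ ∘ c) τ‖ₑ := by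
        gcongr
        exact enorm_sub_le_lintegral_deriv_of_contDiffOn_Icc hu hb.1
    _ = ∫⁻ τ in Ioo 0 b, ENNReal.ofReal (Real.sqrt m) * ‖deriv (ψ ∘ c) τ‖ₑ := by
        rw [lintegral_const_mul' _ _ ENNReal.ofReal_ne_top, restrict_Ioo_eq_restrict_Icc]
    _ ≤ ∫⁻ τ in Ioo 0 b, ENNReal.ofReal
          (Real.sqrt (vertEval g.form (c τ) (velocity c τ) (velocity c τ))) :=
        setLIntegral_mono' measurableSet_Ioo hspeed
    _ ≤ fibreLength g c := lintegral_mono_set (Ioo_subset_Icc_self.trans hsub)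

/-- Short curves in a fibre which start at a given point stay near this point. -/
lemma exists_forall_mem_of_fibreLength_lt [FiniteDimensional ℝ E] [T2Space Y]
    (hπ : MDifferentiable 𝓘(ℝ, ℝ × E) 𝓘(ℝ, ℝ) π)
    (g : RiemannianFibreMetric E π) {ψ : OpenPartialHomeomorph Y (ℝ × E)}
    (hψ : IsBundleChart π ψ) {y : Y} (hy : y ∈ ψ.source) {W : Set Y} (hW : W ∈ 𝓝 y) :
    ∃ r > 0, ∀ c : ℝ → Y, ContMDiffOn 𝓘(ℝ, ℝ) 𝓘(ℝ, ℝ × E) 1 c (Icc 0 1) → c 0 = y →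
      (∀ τ ∈ Icc (0 : ℝ) 1, π (c τ) = π y) → fibreLength g c < ENNReal.ofReal r →
      ∀ τ ∈ Icc (0 : ℝ) 1, c τ ∈ W := by
  have := FiniteDimensional.proper ℝ (ℝ × E)
  have hz₀ := ψ.map_source hy
  obtain ⟨m, hm, hev⟩ := hψ.eventually_mul_sq_norm_le_coordForm g hz₀
  have hWev : ∀ᶠ z in 𝓝 (ψ y), ψ.symm z ∈ W := by
    refine ψ.continuousAt_symm hz₀ ?_
    rwa [ψ.left_inv hy]
  obtain ⟨R, hR, hRsub⟩ := Metric.nhds_basis_closedBall.eventually_iff.1 (hev.and hWev)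
  set C : Set Y := ψ.symm '' Metric.closedBall (ψ y) R
  have hCcl : IsClosed C := ((isCompact_closedBall _ _).image_of_continuousOn
    (ψ.continuousOn_symm.mono fun z hz => (hRsub hz).1.1)).isClosed
  have hC : ∀ x ∈ C, x ∈ ψ.source ∧ ψ x ∈ Metric.closedBall (ψ y) R := by
    rintro _ ⟨z, hz, rfl⟩
    have ht := (hRsub hz).1.1
    exact ⟨ψ.map_target ht, by rwa [ψ.right_inv ht]⟩
  set B : Set Y := ψ.source ∩ ψ ⁻¹' Metric.ball (ψ y) R
  have hBo : IsOpen B := ψ.isOpen_inter_preimage Metric.isOpen_ball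
  have hBC : B ⊆ C := fun x hx => ⟨ψ x, Metric.ball_subset_closedBall hx.2, ψ.left_inv hx.1⟩
  have hsm : 0 < Real.sqrt m := Real.sqrt_pos.2 hm
  refine ⟨Real.sqrt m * R, mul_pos hsm hR, fun c hc hc0 hct hlen => ?_⟩
  have hstep : ∀ b ∈ Icc (0 : ℝ) 1, (∀ τ ∈ Icc 0 b, c τ ∈ C) → c b ∈ B := by
    intro b hb hbC
    have h1 := mul_enorm_sub_le_fibreLength hπ g hψ hm.le hc hct hb
      fun τ hτ => ⟨(hC _ (hbC τ hτ)).1, (hRsub (hC _ (hbC τ hτ)).2).1.2⟩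
    have h2 := h1.trans_lt hlen
    rw [ENNReal.ofReal_mul hsm.le, ENNReal.mul_lt_mul_iff_right (by simpa using hsm)
      ENNReal.ofReal_ne_top, ← ofReal_norm, ENNReal.ofReal_lt_ofReal_iff hR, hc0] at h2
    exact ⟨(hC _ (hbC b (right_mem_Icc.2 hb.1))).1, mem_ball_iff_norm.2 h2⟩
  -- otherwise consider the first time at which the curve leaves `B`
  have hall : ∀ τ ∈ Icc (0 : ℝ) 1, c τ ∈ B := by
    by_contra! hex
    obtain ⟨τ₁, hτ₁, hτ₁B⟩ := hex
    have hcomp : IsCompact (Icc (0 : ℝ) 1 ∩ c ⁻¹' Bᶜ) :=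
      isCompact_Icc.of_isClosed_subset
        (hc.continuousOn.preimage_isClosed_of_isClosed isClosed_Icc hBo.isClosed_compl)
        inter_subset_left
    obtain ⟨b, ⟨hb, hbB⟩, hmin⟩ := hcomp.exists_isLeast ⟨τ₁, hτ₁, hτ₁B⟩
    have hbefore : ∀ τ ∈ Ico 0 b, c τ ∈ B := fun τ hτ => by
      by_contra hτB
      exact absurd (hmin ⟨⟨hτ.1, hτ.2.le.trans hb.2⟩, hτB⟩) (not_le.2 hτ.2)
    have hb0 : b ≠ 0 := by
      rintro rfl
      exact hbB (hc0 ▸ ⟨hy, Metric.mem_ball_self hR⟩)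
    refine hbB (hstep b hb fun τ hτ => ?_)
    rcases hτ.2.eq_or_lt with rfl | hlt
    · have hcont : ContinuousWithinAt c (Ico 0 τ) τ := (hc.continuousOn τ hb).mono
        (Ico_subset_Icc_self.trans (Icc_subset_Icc_right hb.2))
      have hcl := hcont.mem_closure (by rw [closure_Ico hb0.symm]; exact hτ)
        (fun σ hσ => hBC (hbefore σ hσ) : MapsTo c (Ico 0 τ) C)
      rwa [hCcl.closure_eq] at hcl
    · exact hBC (hbefore τ ⟨hτ.1, hlt⟩)
  intro τ hτ
  have h1 := hall τ hτ
  have h2 := (hRsub (Metric.ball_subset_closedBall h1.2)).2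
  rwa [ψ.left_inv h1.1] at h2

variable [T2Space Y] [CompleteSpace E] (hcomp : IsCompleteEquation π γ)

/-- If the flow over the time `h` stretches the vertical vectors along a curve in a fibre at most
by the factor `κ`, then the length of the image of the curve is at most `κ` times its length. -/
lemma fibreLength_flow_comp_le (hγ : IsDynamicEquation π γ)
    (hch : ∀ y : Y, ∃ ψ : OpenPartialHomeomorph Y (ℝ × E), IsBundleChart π ψ ∧ y ∈ ψ.source)
    (hπ : MDifferentiable 𝓘(ℝ, ℝ × E) 𝓘(ℝ, ℝ) π) (g : RiemannianFibreMetric E π)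
    {c : ℝ → Y} {t h κ : ℝ} (hκ : 0 ≤ κ)
    (hc : ContMDiffOn 𝓘(ℝ, ℝ) 𝓘(ℝ, ℝ × E) 1 c (Icc 0 1))
    (hct : ∀ τ ∈ Icc (0 : ℝ) 1, π (c τ) = t)
    (hle : ∀ τ ∈ Icc (0 : ℝ) 1, ∀ v ∈ Vert E π (c τ),
      flowSqNorm hcomp g (c τ) v h ≤ κ ^ 2 * vertEval g.form (c τ) v v) :
    fibreLength g (flow hcomp h ∘ c) ≤ ENNReal.ofReal κ * fibreLength g c := by
  rw [fibreLength, fibreLength, ← lintegral_const_mul' _ _ ENNReal.ofReal_ne_top]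
  refine setLIntegral_mono' measurableSet_Icc fun τ hτ => ?_
  have h1 := ((mdifferentiableAt_flow hcomp hγ hch h (c τ)).hasMFDerivAt.comp_hasMFDerivWithinAt τ
    (hasMFDerivWithinAt_of_contMDiffOn hc hτ)).mfderivWithin (uniqueMDiffWithinAt_unitInterval hτ)
  rw [h1, ← ENNReal.ofReal_mul hκ]
  refine ENNReal.ofReal_le_ofReal ?_
  calc Real.sqrt (flowSqNorm hcomp g (c τ) (velocity c τ) h)
      ≤ Real.sqrt (κ ^ 2 * vertEval g.form (c τ) (velocity c τ) (velocity c τ)) :=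
        Real.sqrt_le_sqrt (hle τ hτ _ (velocity_mem_vert hπ hc hct hτ))
    _ = κ * Real.sqrt (vertEval g.form (c τ) (velocity c τ) (velocity c τ)) := by
        rw [Real.sqrt_mul (sq_nonneg κ), Real.sqrt_sq hκ]

end DynEq

/-! ### Lyapunov stability -/

open DynEq in
theorem corollary1
    {E : Type*} [NormedAddCommGroup E] [NormedSpace ℝ E] [FiniteDimensional ℝ E]
    {M : Type*} [TopologicalSpace M] [ChartedSpace E M] [IsManifold 𝓘(ℝ, E) ∞ M]
    {Y : Type*} [TopologicalSpace Y] [T2Space Y] [SecondCountableTopology Y]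
    [ChartedSpace (ℝ × E) Y] [IsManifold 𝓘(ℝ, ℝ × E) ∞ Y]
    (π : Y → ℝ) (hπ : IsSmoothFibreBundle E M π)
    (γ : ∀ y : Y, TangentSpace 𝓘(ℝ, ℝ × E) y)
    (hγ : IsDynamicEquation π γ) (hcomplete : IsCompleteEquation π γ)
    (g : RiemannianFibreMetric E π)
    (s : ℝ → Y) (hs : IsSolution π γ s) (t₀ : ℝ)
    (hneg : ∃ U : Set Y, IsTubularNhd π γ s U ∧
      ∀ y ∈ U, t₀ ≤ π y → LyapunovNegDefAt γ g y) :
    IsLyapunovStable γ g s := by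
  intro t₁ ε hε
  have := FiniteDimensional.complete ℝ E
  obtain ⟨U, hU, hneg⟩ := hneg
  have hch := hπ.exists_isBundleChart
  have hπd : MDifferentiable 𝓘(ℝ, ℝ × E) 𝓘(ℝ, ℝ) π := hπ.contMDiff.mdifferentiable (by simp)
  -- up to the time `T` the growth of lengths is controlled by compactness, from then on by `hneg`
  set T := max t₀ t₁
  have hT : 0 ≤ T - t₁ := sub_nonneg.2 (le_max_right _ _)
  have hflow : ∀ h, flow hcomplete h (s t₁) = s (t₁ + h) := fun h =>
    (hs.apply_add hcomplete hγ t₁ h).symm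
  obtain ⟨K₀, N, hN, hsN, hK₀⟩ := exists_isOpen_lyapunovLeAt_of_isCompact hγ hch g
    ((isCompact_Icc (a := (0 : ℝ)) (b := T - t₁)).image (continuous_flow_left hcomplete (s t₁)))
  obtain ⟨K, hK0, hK⟩ : ∃ K, 0 ≤ K ∧ ∀ x ∈ N, LyapunovLeAt γ g K x :=
    ⟨max K₀ 0, le_max_right _ _, fun x hx => (hK₀ x hx).mono (le_max_left _ _)⟩
  have hW : ∀ᶠ x in 𝓝 (s t₁), x ∈ U ∧ ∀ h ∈ Icc 0 (T - t₁), flow hcomplete h x ∈ N := by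
    refine Filter.Eventually.and (hU.isOpen.mem_nhds (hU.mem t₁))
      (isCompact_Icc.eventually_forall_of_forall_eventually
        (P := fun x h => flow hcomplete h x ∈ N) fun h hh => ?_)
    have hcont : Continuous fun p : Y × ℝ => flow hcomplete p.2 p.1 :=
      (continuous_flow hcomplete hγ hch).comp continuous_swap
    exact hcont.continuousAt (hN.mem_nhds (hsN (mem_image_of_mem _ hh)))
  obtain ⟨ψ, hψ, hy⟩ := hch (s t₁)
  obtain ⟨r, hr, hstay⟩ := exists_forall_mem_of_fibreLength_lt hπd g hψ hy hW
  set κ := Real.exp (K * (T - t₁) / 2)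
  have hκ : 0 < κ := Real.exp_pos _
  have hκ2 : κ ^ 2 = Real.exp (K * (T - t₁)) := by
    rw [← Real.exp_nat_mul]; congr 1; push_cast; ring
  refine ⟨min r (ε / κ), lt_min hr (div_pos hε hκ), fun s' hs' hdist t ht => ?_⟩
  rw [instDist, fibreEDist] at hdist
  simp only [iInf_lt_iff] at hdist
  obtain ⟨c, ⟨hc, hc0, hc1, hcπ⟩, hlen⟩ := hdist
  have hπs : π (s t₁) = t₁ := hs.section_eq t₁
  have hcW := hstay c hc hc0 hcπ (hlen.trans_le (ENNReal.ofReal_le_ofReal (min_le_left _ _)))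
  set h := t - t₁ with hh
  have hstretch : ∀ τ ∈ Icc (0 : ℝ) 1, ∀ v ∈ Vert E π (c τ),
      flowSqNorm hcomplete g (c τ) v h ≤ κ ^ 2 * vertEval g.form (c τ) v v := by
    intro τ hτ v hv
    obtain ⟨hcU, hcN⟩ := hcW τ hτ
    have hπc : π (c τ) = t₁ := (hcπ τ hτ).trans hπs
    have hfirst : ∀ k ∈ Icc 0 (T - t₁), flowSqNorm hcomplete g (c τ) v k ≤
        κ ^ 2 * vertEval g.form (c τ) v v := by
      intro k hk
      have := flowSqNorm_le_exp_mul hcomplete hγ hch hπd g hv hk.1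
        fun k' hk' => hK _ (hcN k' ⟨hk'.1, hk'.2.trans hk.2⟩)
      rw [flowSqNorm_zero, sub_zero] at this
      refine this.trans (mul_le_mul_of_nonneg_right ?_ (vertEval_self_nonneg g _ _))
      rw [hκ2]
      exact Real.exp_le_exp.2 (mul_le_mul_of_nonneg_left hk.2 hK0)
    rcases le_total h (T - t₁) with hle | hle
    · exact hfirst h ⟨sub_nonneg.2 ht.le, hle⟩
    · have hlater : ∀ k ∈ Icc (T - t₁) h, LyapunovLeAt γ g 0 (flow hcomplete k (c τ)) := by
        intro k hk
        obtain ⟨σ, hσ, hσc⟩ := hcomplete (c τ)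
        have hσk := hσ.apply_add hcomplete hγ (π (c τ)) k
        rw [hσc] at hσk
        refine (hneg _ ?_ ?_).lyapunovLeAt_zero
        · rw [← hσk]
          exact hU.saturated σ hσ ⟨π (c τ), by rwa [hσc]⟩ _
        · rw [proj_flow hcomplete, hπc]
          linarith [hk.1, le_max_left t₀ t₁]
      have := flowSqNorm_le_exp_mul hcomplete hγ hch hπd g hv hle hlater
      rw [zero_mul, Real.exp_zero, one_mul] at this
      exact this.trans (hfirst _ (right_mem_Icc.2 hT))
  have hend : ∀ {σ : ℝ → Y}, IsSolution π γ σ → flow hcomplete h (σ t₁) = σ t := fun hσ => by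
    rw [← hσ.apply_add hcomplete hγ, hh, add_sub_cancel]
  calc instDist g t s s' ≤ fibreLength g (flow hcomplete h ∘ c) := by
        refine iInf₂_le _ ⟨?_, ?_, ?_, fun τ hτ => ?_⟩
        · exact fun τ hτ => (contMDiffAt_flow hcomplete hγ hch h (c τ)).comp_contMDiffWithinAt τ
            (hc τ hτ)
        · rw [Function.comp_apply, hc0, hend hs]
        · rw [Function.comp_apply, hc1, hend hs']
        · rw [Function.comp_apply, proj_flow hcomplete, hcπ τ hτ, hπs, hs.section_eq, hh,
            add_sub_cancel]
    _ ≤ ENNReal.ofReal κ * fibreLength g c :=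
        fibreLength_flow_comp_le hcomplete hγ hch hπd g hκ.le hc hcπ hstretch
    _ < ENNReal.ofReal κ * ENNReal.ofReal (ε / κ) :=
        ENNReal.mul_lt_mul_right (by simpa using hκ) ENNReal.ofReal_ne_top
          (hlen.trans_le (ENNReal.ofReal_le_ofReal (min_le_right _ _)))
    _ = ENNReal.ofReal ε := by
        rw [← ENNReal.ofReal_mul hκ.le, mul_div_cancel₀ _ hκ.ne']
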